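/- There is an absolute constant $C>0$ such that the following holds. Let $d\ge 2$, $n\ge 1$, and let $A_1,\dots,A_n\in\mathbb R^{d\times d}$ be independent random matrices (not necessarily symmetric or identically distributed) such that, for some symmetric positive semidefinite $\Sigma\in\mathbb R^{d\times d}$ and real numbers $\mathcal M,\mathcal V$, for every $i$: (1) $\mathbb E[A_i]=\Sigma$; (2) $\|A_i-\Sigma\|_2\le\mathcal M$ almost surely; (3) $\max\{\|\mathbb E[(A_i-\Sigma)(A_i-\Sigma)^\top]\|_2,\ \|\mathbb E[(A_i-\Sigma)^\top(A_i-\Sigma)]\|_2\}\le\mathcal V$, where $\|\cdot\|_2$ is the spectral norm. Let $v_1,\dots,v_d$ be an orthonormal basis of eigenvectors of $\Sigma$ with eigenvalues $\lambda_1\ge\lambda_2\ge\dots\ge\lambda_d$, and assume $\lambda_1>\lambda_2$. Put $$\beta=40\max\left(\frac{\mathcal M\log d}{\lambda_1-\lambda_2},\ \frac{(\mathcal V+\lambda_1^2)\log^2 d}{(\lambda_1-\lambda_2)^2}\right),\qquad \eta_i=\frac{\log d}{(\lambda_1-\lambda_2)(\beta+i)}\quad(1\le i\le n).$$ Run Oja's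 algorithm: choose $w_0$ uniformly at random from the unit sphere of $\mathbb R^d$, independently of $(A_1,\dots,A_n)$, and for $i=1,\dots,n$ set $$w_i=\frac{w_{i-1}+\eta_iA_iw_{i-1}}{\|w_{i-1}+\eta_iA_iw_{i-1}\|_2}.$$ Then, with probability greater than $3/4$, the output $w_n$ is a well-defined unit vector and $$\sin^2(w_n,v_1):=1-(w_n^\top v_1)^2\ \le\ C\left(\frac{\mathcal V\log d}{(\lambda_1-\lambda_2)^2}\cdot\frac1n+\left(\frac{2\beta}{n}\right)^{2\log d}\right).$$ -/

import Mathlib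

open MeasureTheory ProbabilityTheory
open scoped Matrix

noncomputable section

/-- `ℝᵈ` with the Euclidean norm and inner product. -/
abbrev Vec (d : ℕ) : Type := EuclideanSpace ℝ (Fin d)

/-- Real `d × d` matrices. -/
abbrev Mat (d : ℕ) : Type := Matrix (Fin d) (Fin d) ℝ

/-- Matrices carry the product (Borel) σ-algebra of their entries. -/
instance instMeasurableSpaceMat (d : ℕ) : MeasurableSpace (Mat d) :=
  inferInstanceAs (MeasurableSpace (Fin d → Fin d → ℝ))

/-- The matrix-vector product, as a vector of Euclidean space. -/
def matVec {d : ℕ} (A : Mat d) (w : Vec d) : Vec d :=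
  Matrix.toEuclideanCLM (𝕜 := ℝ) A w

/-- The spectral norm: the operator norm of `A` acting on Euclidean space. -/
def specNorm {d : ℕ} (A : Mat d) : ℝ :=
  ‖Matrix.toEuclideanCLM (𝕜 := ℝ) A‖

/-- The (entrywise) expectation of a random matrix. -/
def expMat {Ω : Type*} [MeasurableSpace Ω] {d : ℕ} (P : Measure Ω) (X : Ω → Mat d) : Mat d :=
  Matrix.of fun i j => ∫ ω, X ω i j ∂P

/-- The streaming PCA model: `A 0, …, A (n - 1)` (the samples `A₁, …, Aₙ`) are independent, not
necessarily symmetric or identically distributed, random matrices with common positive semidefinite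
mean `S`, almost sure deviation bound `M` and variance bound `V`. -/
structure StreamingPCA {Ω : Type*} [MeasurableSpace Ω] (P : Measure Ω) {d n : ℕ}
    (A : Fin n → Ω → Mat d) (S : Mat d) (M V : ℝ) : Prop where
  measurable : ∀ i, Measurable (A i)
  indep : iIndepFun A P
  posSemidef : S.PosSemidef
  mean : ∀ i, expMat P (A i) = S
  bound : ∀ i, ∀ᵐ ω ∂P, specNorm (A i ω - S) ≤ M
  variance : ∀ i,
    max (specNorm (expMat P fun ω => (A i ω - S) * (A i ω - S)ᵀ))
        (specNorm (expMat P fun ω => (A i ω - S)ᵀ * (A i ω - S))) ≤ V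

/-- `v` is an orthonormal basis of eigenvectors of `S`, with corresponding eigenvalues
`lam 0 ≥ lam 1 ≥ …`. -/
structure IsOrderedEigenbasis {d : ℕ} (S : Mat d) (lam : Fin d → ℝ)
    (v : OrthonormalBasis (Fin d) ℝ (Vec d)) : Prop where
  antitone : Antitone lam
  eigen : ∀ i, matVec S (v i) = lam i • v i

/-- The uniform probability distribution on the unit sphere of `ℝᵈ`: normalized surface measure. -/
def uniformSphere (d : ℕ) : Measure (Metric.sphere (0 : Vec d) 1) :=
  ((volume : Measure (Vec d)).toSphere Set.univ)⁻¹ • (volume : Measure (Vec d)).toSphere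

/-- One step of Oja's algorithm: `w ↦ (w + η A w) / ‖w + η A w‖`. -/
def ojaStep {d : ℕ} (η : ℝ) (A : Mat d) (w : Vec d) : Vec d :=
  ‖w + η • matVec A w‖⁻¹ • (w + η • matVec A w)

/-- The output `wₙ` of Oja's algorithm on the `n` matrices `A 0, …, A (n - 1)` with initial vector
`w₀`; the `t`-th step (`t = 1, …, n`) uses the matrix `A (t - 1)` and the step size `η t`. -/
def ojaOutput {d : ℕ} (η : ℕ → ℝ) : (n : ℕ) → (Fin n → Mat d) → Vec d → Vec d
  | 0, _, w₀ => w₀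
  | n + 1, A, w₀ =>
      ojaStep (η (n + 1)) (A (Fin.last n)) (ojaOutput η n (fun i => A i.castSucc) w₀)

/-- The offset `β`, as a function of `d`, `λ₁`, `λ₂`, `M`, `V`. -/
def ojaBeta (d : ℕ) (l₁ l₂ M V : ℝ) : ℝ :=
  40 * max (M * Real.log d / (l₁ - l₂)) ((V + l₁ ^ 2) * Real.log d ^ 2 / (l₁ - l₂) ^ 2)

/-- The step sizes `ηᵢ = log d / ((λ₁ - λ₂) (β + i))`. -/
def ojaStepSize (d : ℕ) (l₁ l₂ M V : ℝ) (i : ℕ) : ℝ :=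
  Real.log d / ((l₁ - l₂) * (ojaBeta d l₁ l₂ M V + i))

/-- `sin²` of the angle between unit vectors `w` and `v`. -/
def sinSq {d : ℕ} (w v : Vec d) : ℝ := 1 - (inner ℝ w v) ^ 2

end

/-! Normalization can be postponed: `w_n` is the direction of `B w₀`, where `B` is the product of
the factors `1 + ηᵢ Aᵢ` (`ojaOutput_eq`). Hence `sin²` is at most `‖perp v₁ (B w₀)‖² / ⟨v₁, B w₀⟩²`
(`sinSq_smul_le`). Let `G = ∏ (1 + ηᵢ λ₁)`.

Denominator: `⟨v₁, B w₀⟩ = ⟨Bᵀ v₁, w₀⟩`, and a uniform `w₀` satisfies `|⟨u, w₀⟩| ≥ c ‖u‖ / √d`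
outside an event of probability `2c` (`uniformSphere_abs_inner_lt_le`). Moreover `‖Bᵀ v₁‖ ≥ ⟨v₁, B
v₁⟩`, and `⟨v₁, B v₁⟩ / G` is a martingale started at 1 with variance at most 13/500, so it exceeds
1/2 with high probability by Chebyshev.

Numerator: averaging over `w₀` gives the squared Frobenius norm of `perp v₁ ∘ B` divided by `d`. Its
expectation is at most `τ = residualBound`, and Markov applies. Relative to `G²`, one step contracts
`τ` by about `exp (-2 η (λ₁ - λ₂))` and adds about `η² V`. The added term involves only `𝔼 ‖Bᵀ
v₁‖²`, not the full Frobenius norm of `B`, which saves a factor `d`.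

The two factors `1/d` cancel and `τ / G²` remains. With `L = log d` and `t = β + i` the contraction
is `exp (-2L/t)`: the initial `d` decays like `n ^ (-2L)` and the injected noise like `1/n`
(`residualBound_le_rate`). The choice of `β` keeps `∑ ηᵢ² (V + λ₁²) ≤ 1/40`, so second-order
corrections cost only constant factors. The three bad events have total probability at most 13/125 +
1/20 + 1/20 < 1/4. -/

open scoped ENNReal Pointwise

noncomputable section

/-! ### Uniform measure on the sphere: second moments and anti-concentration. -/

section Sphere

lemma uniformSphere_apply {d : ℕ} [NeZero d] {s : Set (Metric.sphere (0 : Vec d) 1)}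
    (hs : MeasurableSet s) :
    uniformSphere d s = (volume (Metric.ball (0 : Vec d) 1))⁻¹ *
      volume (Set.Ioo (0 : ℝ) 1 • ((↑) '' s : Set (Vec d))) := by
  have hd : (d : ℝ≥0∞) ≠ 0 := by exact_mod_cast NeZero.ne d
  simp only [uniformSphere, Measure.smul_apply, Measure.toSphere_apply_univ,
    Measure.toSphere_apply' _ hs, smul_eq_mul, finrank_euclideanSpace, Fintype.card_fin]
  rw [ENNReal.mul_inv (Or.inl hd) (Or.inl (by simp)), mul_mul_mul_comm,
    ENNReal.inv_mul_cancel hd (by simp), one_mul]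

instance isProbabilityMeasure_uniformSphere {d : ℕ} [NeZero d] :
    IsProbabilityMeasure (uniformSphere d) := by
  refine ⟨?_⟩
  rw [uniformSphere, Measure.smul_apply, smul_eq_mul]
  refine ENNReal.inv_mul_cancel ?_ (measure_ne_top _ _)
  have : Nontrivial (Vec d) := by
    have : Nonempty (Fin d) := ⟨0⟩
    infer_instance
  exact (Measure.measure_univ_ne_zero).2 (Measure.toSphere_ne_zero _)

/-- The action of a linear isometry on the unit sphere. -/
def sphereMap {d : ℕ} (g : Vec d ≃ₗᵢ[ℝ] Vec d) (w : Metric.sphere (0 : Vec d) 1) :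
    Metric.sphere (0 : Vec d) 1 :=
  ⟨g w, by simp⟩

lemma measurable_sphereMap {d : ℕ} (g : Vec d ≃ₗᵢ[ℝ] Vec d) : Measurable (sphereMap g) :=
  (g.continuous.measurable.comp measurable_subtype_coe).subtype_mk

lemma measurePreserving_sphereMap {d : ℕ} [NeZero d] (g : Vec d ≃ₗᵢ[ℝ] Vec d) :
    MeasurePreserving (sphereMap g) (uniformSphere d) (uniformSphere d) := by
  refine ⟨measurable_sphereMap g, Measure.ext fun s hs => ?_⟩
  rw [Measure.map_apply (measurable_sphereMap g) hs, uniformSphere_apply hs,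
    uniformSphere_apply (measurable_sphereMap g hs)]
  congr 1
  have hvol : MeasurePreserving g volume volume := g.measurePreserving
  have hg : MeasurableEmbedding g := g.toHomeomorph.measurableEmbedding
  rw [← hvol.measure_preimage_emb hg (Set.Ioo (0 : ℝ) 1 • ((↑) '' s : Set (Vec d)))]
  congr 1
  ext x
  simp only [Set.mem_smul, Set.mem_image, Set.mem_preimage]
  constructor
  · rintro ⟨t, ht, _, ⟨w, hw, rfl⟩, rfl⟩
    exact ⟨t, ht, _, ⟨_, hw, rfl⟩, by simp [sphereMap]⟩
  · rintro ⟨t, ht, _, ⟨w, hw, rfl⟩, h⟩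
    refine ⟨t, ht, _, ⟨sphereMap g.symm w, ?_, rfl⟩, ?_⟩
    · have : sphereMap g (sphereMap g.symm w) = w := Subtype.ext (by simp [sphereMap])
      rwa [this]
    · apply g.injective
      rw [← h]
      simp [sphereMap]

/-- The reflection in the hyperplane orthogonal to `u - u'` sends `u` to `u'` and preserves the
uniform measure. -/
lemma lintegral_inner_sq_eq_of_norm_eq {d : ℕ} [NeZero d] {u u' : Vec d} (h : ‖u‖ = ‖u'‖) :
    ∫⁻ w : Metric.sphere (0 : Vec d) 1, ENNReal.ofReal (inner ℝ u (w : Vec d) ^ 2)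
      ∂uniformSphere d =
    ∫⁻ w : Metric.sphere (0 : Vec d) 1, ENNReal.ofReal (inner ℝ u' (w : Vec d) ^ 2)
      ∂uniformSphere d := by
  set g := (ℝ ∙ (u - u'))ᗮ.reflection
  have hg : g u = u' := Submodule.reflection_sub h
  rw [← (measurePreserving_sphereMap g).lintegral_comp
    (f := fun w => ENNReal.ofReal (inner ℝ u' (w : Vec d) ^ 2)) (by fun_prop)]
  refine lintegral_congr fun w => ?_
  rw [← hg, sphereMap, g.inner_map_map]

/-- By symmetry all coordinates have the same second moment, and their squares sum to 1. -/
lemma lintegral_inner_sq_uniformSphere {d : ℕ} [NeZero d] (u : Vec d) :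
    ∫⁻ w : Metric.sphere (0 : Vec d) 1, ENNReal.ofReal (inner ℝ u (w : Vec d) ^ 2)
      ∂uniformSphere d = ENNReal.ofReal (‖u‖ ^ 2 / d) := by
  have hd : (d : ℝ≥0∞) ≠ 0 := by exact_mod_cast NeZero.ne d
  set b := EuclideanSpace.basisFun (Fin d) ℝ
  have key : ∀ k : Fin d, ∫⁻ w : Metric.sphere (0 : Vec d) 1,
      ENNReal.ofReal (inner ℝ u (w : Vec d) ^ 2) ∂uniformSphere d =
      ENNReal.ofReal (‖u‖ ^ 2) * ∫⁻ w : Metric.sphere (0 : Vec d) 1,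
        ENNReal.ofReal (inner ℝ (b k) (w : Vec d) ^ 2) ∂uniformSphere d := by
    intro k
    rw [lintegral_inner_sq_eq_of_norm_eq (u' := ‖u‖ • b k) (by simp [norm_smul, b]),
      ← lintegral_const_mul _ (by fun_prop)]
    refine lintegral_congr fun w => ?_
    rw [real_inner_smul_left, mul_pow, ENNReal.ofReal_mul (by positivity)]
  have hsum : (d : ℝ≥0∞) * ∫⁻ w : Metric.sphere (0 : Vec d) 1,
      ENNReal.ofReal (inner ℝ u (w : Vec d) ^ 2) ∂uniformSphere d = ENNReal.ofReal (‖u‖ ^ 2) := by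
    calc _ = ∑ k : Fin d, ∫⁻ w : Metric.sphere (0 : Vec d) 1,
          ENNReal.ofReal (inner ℝ u (w : Vec d) ^ 2) ∂uniformSphere d := by simp
      _ = ENNReal.ofReal (‖u‖ ^ 2) * ∫⁻ w : Metric.sphere (0 : Vec d) 1,
          ∑ k, ENNReal.ofReal (inner ℝ (b k) (w : Vec d) ^ 2) ∂uniformSphere d := by
        rw [lintegral_finsetSum _ (fun k _ => by fun_prop), Finset.mul_sum]
        exact Finset.sum_congr rfl fun k _ => key k
      _ = ENNReal.ofReal (‖u‖ ^ 2) := by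
        have : ∀ w : Metric.sphere (0 : Vec d) 1,
            ∑ k, ENNReal.ofReal (inner ℝ (b k) (w : Vec d) ^ 2) = 1 := by
          intro w
          rw [← ENNReal.ofReal_sum_of_nonneg (fun _ _ => sq_nonneg _), b.sum_sq_inner_right]
          simp
        simp [this]
  rw [ENNReal.ofReal_div_of_pos (by exact_mod_cast Nat.pos_of_ne_zero (NeZero.ne d)), ← hsum,
    ENNReal.ofReal_natCast, mul_comm, ENNReal.mul_div_cancel_right hd (by simp)]

/-- With `k = d - 1`, the square of the right side is `(1 + 1/k) ^ (-k) ≥ 1/e ≥ 1/4`. -/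
lemma half_le_sqrt_one_sub_inv_pow {d : ℕ} (hd : 2 ≤ d) :
    1 / 2 ≤ √(1 - 1 / (d : ℝ)) ^ (d - 1) := by
  obtain ⟨k, rfl⟩ : ∃ k, d = k + 1 := ⟨d - 1, by omega⟩
  have hk : (0 : ℝ) < k := by exact_mod_cast (by omega : 0 < k)
  have h1 : (1 - 1 / ((k + 1 : ℕ) : ℝ)) = (1 + (k : ℝ)⁻¹)⁻¹ := by
    push_cast; field_simp; ring
  have h2 : (1 + (k : ℝ)⁻¹) ^ k ≤ 4 := by
    calc (1 + (k : ℝ)⁻¹) ^ k ≤ (Real.exp ((k : ℝ)⁻¹)) ^ k := by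
          gcongr; rw [add_comm]; exact Real.add_one_le_exp _
      _ = Real.exp 1 := by rw [← Real.exp_nat_mul, mul_inv_cancel₀ hk.ne']
      _ ≤ 4 := by linarith [Real.exp_one_lt_d9]
  rw [h1, Nat.add_sub_cancel]
  have h3 : (√(1 + (k : ℝ)⁻¹)⁻¹ ^ k) ^ 2 = ((1 + (k : ℝ)⁻¹) ^ k)⁻¹ := by
    rw [← pow_mul, mul_comm, pow_mul, Real.sq_sqrt (by positivity), inv_pow]
  refine le_of_sq_le_sq ?_ (by positivity)
  rw [h3]
  calc ((1 : ℝ) / 2) ^ 2 = 4⁻¹ := by norm_num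
    _ ≤ _ := inv_anti₀ (by positivity) h2

/-- A linear map that stretches by `1/c` along `u` and shrinks by `b = √(1 - 1/d)` across it carries
the slab into the unit ball, since `b² + 1/d = 1`. Its determinant `c⁻¹ b ^ (d - 1)` is at least
`1/(2c)`, so comparing volumes gives the bound. -/
lemma volume_slab_le {d : ℕ} (hd : 2 ≤ d) {u : Vec d} (hu : ‖u‖ = 1) {c : ℝ} (hc : 0 < c) :
    volume {x : Vec d | ‖x‖ < 1 ∧ |inner ℝ u x| < c / √d} ≤
      ENNReal.ofReal (2 * c) * volume (Metric.ball (0 : Vec d) 1) := by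
  have hd0 : (0 : ℝ) < d := by exact_mod_cast (by omega : 0 < d)
  set b : ℝ := √(1 - 1 / (d : ℝ)) with hb
  have hd1 : 1 / (d : ℝ) < 1 := by
    rw [div_lt_one hd0]; exact_mod_cast (by omega : 1 < d)
  have hbpos : 0 < b := Real.sqrt_pos.2 (by linarith)
  have hbsq : b ^ 2 = 1 - 1 / (d : ℝ) := Real.sq_sqrt (by linarith)
  set f : Module.Dual ℝ (Vec d) := (1 / (c * b) - 1) • (innerSL ℝ u : Vec d →ₗ[ℝ] ℝ) with hf
  set T : Vec d →ₗ[ℝ] Vec d := b • LinearMap.transvection f u with hT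
  have hTx : ∀ x, T x = b • (x + ((1 / (c * b) - 1) * inner ℝ u x) • u) := by
    intro x
    simp [T, f, LinearMap.transvection]
  have hdet : LinearMap.det T = c⁻¹ * b ^ (d - 1) := by
    rw [hT, LinearMap.det_smul, LinearMap.transvection.det, finrank_euclideanSpace_fin]
    have : f u = 1 / (c * b) - 1 := by simp [hf, hu]
    rw [this]
    obtain ⟨k, rfl⟩ : ∃ k, d = k + 1 := ⟨d - 1, by omega⟩
    rw [Nat.add_sub_cancel, pow_succ]
    field_simp
    ring
  set Z : Set (Vec d) := {x : Vec d | ‖x‖ < 1 ∧ |inner ℝ u x| < c / √d} with hZ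
  have himg : T '' Z ⊆ Metric.ball 0 1 := by
    rintro _ ⟨x, ⟨hx1, hx2⟩, rfl⟩
    rw [mem_ball_zero_iff]
    set t : ℝ := inner ℝ u x with ht
    have ht' : t ^ 2 < c ^ 2 / d := by
      have := sq_lt_sq' (abs_lt.1 hx2).1 (abs_lt.1 hx2).2
      rwa [div_pow, Real.sq_sqrt hd0.le] at this
    have hnorm : ‖T x‖ ^ 2 = b ^ 2 * (‖x‖ ^ 2 - t ^ 2) + t ^ 2 / c ^ 2 := by
      rw [hTx, norm_smul, mul_pow, norm_add_sq_real, real_inner_smul_right, real_inner_comm u x, ← ht,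
        norm_smul, hu]
      simp only [Real.norm_eq_abs, sq_abs, mul_one, mul_pow]
      field_simp
      ring
    have h1 : ‖x‖ ^ 2 < 1 := by nlinarith [norm_nonneg x]
    have h2 : t ^ 2 / c ^ 2 < 1 / d := by
      rw [div_lt_iff₀ (by positivity)]
      calc t ^ 2 < c ^ 2 / d := ht'
        _ = _ := by ring
    have : ‖T x‖ ^ 2 < 1 := by
      rw [hnorm]
      nlinarith [sq_nonneg t, mul_pos hbpos hbpos]
    nlinarith [norm_nonneg (T x)]
  have hvol := measure_mono (μ := volume) himg
  rw [Measure.addHaar_image_linearMap, hdet] at hvol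
  have hhalf := half_le_sqrt_one_sub_inv_pow hd
  rw [← hb] at hhalf
  have h2 : ENNReal.ofReal ((2 * c)⁻¹) * volume Z ≤ volume (Metric.ball (0 : Vec d) 1) := by
    refine le_trans ?_ hvol
    gcongr
    refine le_trans ?_ (le_abs_self _)
    rw [mul_inv, mul_comm]
    gcongr
    simpa using hhalf
  calc volume Z = ENNReal.ofReal (2 * c) * (ENNReal.ofReal ((2 * c)⁻¹) * volume Z) := by
        rw [← mul_assoc, ← ENNReal.ofReal_mul (by positivity), mul_inv_cancel₀ (by positivity)]
        simp
    _ ≤ _ := by gcongr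

/-- The cone over the spherical band lies in the slab of `volume_slab_le`, because scaling by `t <
1` only decreases the inner product. -/
lemma uniformSphere_abs_inner_lt_le {d : ℕ} (hd : 2 ≤ d) (u : Vec d) {c : ℝ} (hc : 0 < c) :
    uniformSphere d {w | |inner ℝ u (w : Vec d)| < c * ‖u‖ / √d} ≤ ENNReal.ofReal (2 * c) := by
  have : NeZero d := ⟨by omega⟩
  rcases eq_or_ne u 0 with rfl | hu0
  · simp
  have hu : 0 < ‖u‖ := norm_pos_iff.2 hu0
  have hmeas : MeasurableSet {w : Metric.sphere (0 : Vec d) 1 |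
      |inner ℝ u (w : Vec d)| < c * ‖u‖ / √d} := by
    refine measurableSet_lt ?_ measurable_const
    fun_prop
  rw [uniformSphere_apply hmeas]
  set e : Vec d := ‖u‖⁻¹ • u
  have he : ‖e‖ = 1 := by simp [e, norm_smul, hu.ne']
  have hsub : Set.Ioo (0 : ℝ) 1 • ((↑) '' {w : Metric.sphere (0 : Vec d) 1 |
      |inner ℝ u (w : Vec d)| < c * ‖u‖ / √d} : Set (Vec d)) ⊆
      {x : Vec d | ‖x‖ < 1 ∧ |inner ℝ e x| < c / √d} := by
    rintro _ ⟨t, ⟨ht0, ht1⟩, _, ⟨w, hw, rfl⟩, rfl⟩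
    have hw' : ‖(w : Vec d)‖ = 1 := by simp
    refine ⟨?_, ?_⟩
    · simpa [norm_smul, abs_of_pos ht0] using ht1
    · have h1 : |inner ℝ e (w : Vec d)| < c / √d := by
        simp only [e, real_inner_smul_left, abs_mul, abs_inv, abs_norm]
        rw [inv_mul_lt_iff₀ hu]
        calc _ < _ := hw
          _ = _ := by ring
      simp only [real_inner_smul_right, abs_mul, abs_of_pos ht0]
      nlinarith [abs_nonneg (inner ℝ e (w : Vec d))]
  have hball : volume (Metric.ball (0 : Vec d) 1) ≠ 0 :=
    (Metric.measure_ball_pos _ _ one_pos).ne'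
  calc _ ≤ (volume (Metric.ball (0 : Vec d) 1))⁻¹ *
        (ENNReal.ofReal (2 * c) * volume (Metric.ball (0 : Vec d) 1)) := by
        gcongr
        exact (measure_mono hsub).trans (volume_slab_le hd he hc)
    _ = _ := by
      rw [mul_left_comm, ENNReal.inv_mul_cancel hball measure_ball_lt_top.ne, mul_one]

end Sphere

/-! ### Matrices acting on Euclidean space. -/

section MatVec

variable {d : ℕ}

lemma matVec_smul (A : Mat d) (c : ℝ) (x : Vec d) : matVec A (c • x) = c • matVec A x := by
  simp [matVec]

lemma add_matVec (A B : Mat d) (x : Vec d) : matVec (A + B) x = matVec A x + matVec B x := by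
  simp [matVec]

lemma sub_matVec (A B : Mat d) (x : Vec d) : matVec (A - B) x = matVec A x - matVec B x := by
  simp [matVec]

lemma smul_matVec (c : ℝ) (A : Mat d) (x : Vec d) : matVec (c • A) x = c • matVec A x := by
  simp [matVec]

lemma one_matVec (x : Vec d) : matVec (1 : Mat d) x = x := by
  simp [matVec]

lemma mul_matVec (A B : Mat d) (x : Vec d) : matVec (A * B) x = matVec A (matVec B x) := by
  simp [matVec]

lemma inner_matVec (A : Mat d) (x y : Vec d) :
    inner ℝ x (matVec A y) = ∑ i, ∑ j, x i * (A i j * y j) := by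
  rw [matVec, Matrix.inner_toEuclideanCLM]
  simp [dotProduct, Matrix.mulVec, Finset.mul_sum]

lemma inner_matVec_transpose (A : Mat d) (x y : Vec d) :
    inner ℝ (matVec Aᵀ x) y = inner ℝ x (matVec A y) := by
  rw [real_inner_comm, inner_matVec, inner_matVec, Finset.sum_comm]
  refine Finset.sum_congr rfl fun i _ => Finset.sum_congr rfl fun j _ => ?_
  rw [Matrix.transpose_apply]; ring

lemma norm_matVec_le (A : Mat d) (x : Vec d) : ‖matVec A x‖ ≤ specNorm A * ‖x‖ :=
  ContinuousLinearMap.le_opNorm _ _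

lemma specNorm_nonneg (A : Mat d) : 0 ≤ specNorm A := norm_nonneg _

lemma norm_matVec_sq (A : Mat d) (x : Vec d) :
    ‖matVec A x‖ ^ 2 = inner ℝ x (matVec (Aᵀ * A) x) := by
  rw [mul_matVec, ← inner_matVec_transpose, Matrix.transpose_transpose,
    real_inner_self_eq_norm_sq]

lemma inner_matVec_le (A : Mat d) (x : Vec d) :
    inner ℝ x (matVec A x) ≤ specNorm A * ‖x‖ ^ 2 := by
  calc _ ≤ ‖x‖ * ‖matVec A x‖ := real_inner_le_norm _ _
    _ ≤ ‖x‖ * (specNorm A * ‖x‖) := by gcongr; exact norm_matVec_le A x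
    _ = _ := by ring

lemma abs_entry_le_specNorm (A : Mat d) (i j : Fin d) : |A i j| ≤ specNorm A := by
  have h : inner ℝ (EuclideanSpace.single i (1 : ℝ)) (matVec A (EuclideanSpace.single j 1)) =
      A i j := by
    rw [inner_matVec]
    simp
  rw [← h]
  refine (abs_real_inner_le_norm _ _).trans ?_
  simpa using norm_matVec_le A (EuclideanSpace.single j (1 : ℝ))

lemma specNorm_transpose (A : Mat d) : specNorm Aᵀ = specNorm A := by
  open scoped Matrix.Norms.L2Operator in
  have h := Matrix.l2_opNorm_conjTranspose A
  rwa [Matrix.conjTranspose_eq_transpose_of_trivial] at h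

instance borelSpace_mat : BorelSpace (Mat d) := inferInstanceAs (BorelSpace (Fin d → Fin d → ℝ))

instance secondCountableTopology_mat : SecondCountableTopology (Mat d) :=
  inferInstanceAs (SecondCountableTopology (Fin d → Fin d → ℝ))

@[fun_prop]
lemma Continuous.matVec {X : Type*} [TopologicalSpace X] {A : X → Mat d} {x : X → Vec d}
    (hA : Continuous A) (hx : Continuous x) : Continuous fun t => matVec (A t) (x t) := by
  refine (PiLp.continuous_toLp 2 _).comp ?_
  exact hA.matrix_mulVec ((PiLp.continuous_ofLp 2 _).comp hx)

end MatVec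

/-! ### Second moments of a centred noise matrix. -/

section Moments

variable {d : ℕ} {Ω : Type*} [MeasurableSpace Ω] {μ : Measure Ω}

lemma integrable_inner_matVec {Y : Ω → Mat d}
    (hY : ∀ i j, Integrable (fun ω => Y ω i j) μ) (q x : Vec d) :
    Integrable (fun ω => inner ℝ q (matVec (Y ω) x)) μ := by
  simp_rw [inner_matVec]
  exact integrable_finsetSum _ fun i _ => integrable_finsetSum _ fun j _ =>
    ((hY i j).mul_const _).const_mul _

lemma integral_inner_matVec {Y : Ω → Mat d}
    (hY : ∀ i j, Integrable (fun ω => Y ω i j) μ) (q x : Vec d) :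
    ∫ ω, inner ℝ q (matVec (Y ω) x) ∂μ = inner ℝ q (matVec (expMat μ Y) x) := by
  simp_rw [inner_matVec]
  rw [integral_finsetSum _ fun i _ => integrable_finsetSum _ fun j _ =>
    ((hY i j).mul_const _).const_mul _]
  refine Finset.sum_congr rfl fun i _ => ?_
  rw [integral_finsetSum _ fun j _ => ((hY i j).mul_const _).const_mul _]
  refine Finset.sum_congr rfl fun j _ => ?_
  rw [integral_const_mul, integral_mul_const]
  rfl

/-- `Y` is a centred, bounded random matrix with `‖𝔼 Yᵀ Y‖ ≤ V`. -/
structure IsCentredNoise (μ : Measure Ω) (Y : Ω → Mat d) (M V : ℝ) : Prop where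
  measurable : Measurable Y
  bound : ∀ᵐ ω ∂μ, specNorm (Y ω) ≤ M
  mean : expMat μ Y = 0
  variance : specNorm (expMat μ fun ω => (Y ω)ᵀ * Y ω) ≤ V

lemma IsCentredNoise.integrable [IsFiniteMeasure μ] {Y : Ω → Mat d} {M V : ℝ}
    (h : IsCentredNoise μ Y M V) (i j : Fin d) : Integrable (fun ω => Y ω i j) μ := by
  refine Integrable.of_bound (C := M) ?_ ?_
  · exact ((measurable_pi_apply j).comp
      ((measurable_pi_apply i).comp h.measurable)).aestronglyMeasurable
  · filter_upwards [h.bound] with ω hω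
    exact (abs_entry_le_specNorm _ i j).trans hω

lemma IsCentredNoise.integrable_sq [IsFiniteMeasure μ] {Y : Ω → Mat d} {M V : ℝ}
    (h : IsCentredNoise μ Y M V) (i j : Fin d) :
    Integrable (fun ω => ((Y ω)ᵀ * Y ω) i j) μ := by
  simp_rw [Matrix.mul_apply, Matrix.transpose_apply]
  refine integrable_finsetSum _ fun k _ => (h.integrable k i).mul_bdd (c := M) ?_ ?_
  · exact (h.integrable k j).aestronglyMeasurable
  · filter_upwards [h.bound] with ω hω
    exact (abs_entry_le_specNorm _ k j).trans hω

/-- Expanding the square, the cross term vanishes in the mean and `𝔼 ‖Y x‖² = ⟨x, 𝔼[Yᵀ Y] x⟩`.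
Leaving `L` general covers the full norm, the projection `perp` and a single coordinate at once. -/
lemma IsCentredNoise.lintegral_norm_add_sq_le [IsProbabilityMeasure μ] {Y : Ω → Mat d} {M V : ℝ}
    (h : IsCentredNoise μ Y M V) {F : Type*} [NormedAddCommGroup F] [InnerProductSpace ℝ F]
    [CompleteSpace F] (L : Vec d →L[ℝ] F) {ℓ : ℝ} (hℓ : 0 ≤ ℓ)
    (hL : ∀ y, ‖L y‖ ^ 2 ≤ ℓ * ‖y‖ ^ 2) (p : F) (x : Vec d) :
    ∫⁻ ω, ENNReal.ofReal (‖p + L (matVec (Y ω) x)‖ ^ 2) ∂μ ≤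
      ENNReal.ofReal (‖p‖ ^ 2 + ℓ * (V * ‖x‖ ^ 2)) := by
  set q : Vec d := ContinuousLinearMap.adjoint L p
  have hle : ∀ ω, ‖p + L (matVec (Y ω) x)‖ ^ 2 ≤ ‖p‖ ^ 2 + 2 * inner ℝ q (matVec (Y ω) x) +
      ℓ * inner ℝ x (matVec ((Y ω)ᵀ * Y ω) x) := by
    intro ω
    rw [norm_add_sq_real, ← ContinuousLinearMap.adjoint_inner_left, ← norm_matVec_sq]
    linarith [hL (matVec (Y ω) x)]
  have hi1 : Integrable (fun ω => ‖p‖ ^ 2 + 2 * inner ℝ q (matVec (Y ω) x)) μ :=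
    (integrable_const _).add ((integrable_inner_matVec h.integrable q x).const_mul 2)
  have hi2 : Integrable (fun ω => ℓ * inner ℝ x (matVec ((Y ω)ᵀ * Y ω) x)) μ :=
    (integrable_inner_matVec h.integrable_sq x x).const_mul ℓ
  have hi : Integrable (fun ω => ‖p‖ ^ 2 + 2 * inner ℝ q (matVec (Y ω) x) +
      ℓ * inner ℝ x (matVec ((Y ω)ᵀ * Y ω) x)) μ := hi1.add hi2
  refine (lintegral_mono fun ω => ENNReal.ofReal_le_ofReal (hle ω)).trans ?_
  rw [← ofReal_integral_eq_lintegral_ofReal hi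
    (ae_of_all _ fun ω => (sq_nonneg _).trans (hle ω))]
  refine ENNReal.ofReal_le_ofReal ?_
  rw [integral_add hi1 hi2, integral_add (integrable_const _)
    ((integrable_inner_matVec h.integrable q x).const_mul 2), integral_const_mul,
    integral_const_mul, integral_inner_matVec h.integrable, integral_inner_matVec h.integrable_sq,
    h.mean]
  have h0 : matVec (0 : Mat d) x = 0 := by simp [matVec]
  have h1 : inner ℝ x (matVec (expMat μ fun ω => (Y ω)ᵀ * Y ω) x) ≤ V * ‖x‖ ^ 2 :=
    (inner_matVec_le _ x).trans (by gcongr; exact h.variance)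
  simp only [h0, inner_zero_right, integral_const, probReal_univ, smul_eq_mul, mul_zero, add_zero,
    one_mul]
  gcongr

end Moments

/-! ### Spectral bounds for `1 + η S`, on the whole space and off the top eigenvector. -/

section Eigenbasis

variable {d : ℕ} {S : Mat d} {lam : Fin d → ℝ} {v : OrthonormalBasis (Fin d) ℝ (Vec d)}

lemma IsOrderedEigenbasis.inner_matVec_eq (h : IsOrderedEigenbasis S lam v) (hS : Sᵀ = S)
    (i : Fin d) (x : Vec d) : inner ℝ (v i) (matVec S x) = lam i * inner ℝ (v i) x := by
  rw [← inner_matVec_transpose, hS, h.eigen, real_inner_smul_left]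

lemma IsOrderedEigenbasis.nonneg (h : IsOrderedEigenbasis S lam v) (hS : S.PosSemidef)
    (i : Fin d) : 0 ≤ lam i := by
  have h1 := h.inner_matVec_eq (by simpa using hS.isHermitian.eq) i (v i)
  rw [real_inner_self_eq_norm_sq, v.norm_eq_one, one_pow, mul_one] at h1
  rw [← h1, matVec, Matrix.inner_toEuclideanCLM]
  simpa using hS.dotProduct_mulVec_nonneg (v i).ofLp

/-- The projection onto the orthogonal complement of a unit vector `u`. -/
def perp (u : Vec d) : Vec d →L[ℝ] Vec d :=
  ContinuousLinearMap.id ℝ _ - (innerSL ℝ u).smulRight u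

lemma perp_apply (u x : Vec d) : perp u x = x - inner ℝ u x • u := by
  simp [perp]

lemma norm_perp_sq {u : Vec d} (hu : ‖u‖ = 1) (x : Vec d) :
    ‖perp u x‖ ^ 2 = ‖x‖ ^ 2 - inner ℝ u x ^ 2 := by
  rw [perp_apply, norm_sub_sq_real, real_inner_smul_right, real_inner_comm, norm_smul, hu]
  simp only [Real.norm_eq_abs, mul_one, sq_abs]
  ring

lemma norm_perp_sq_eq_sum (v : OrthonormalBasis (Fin d) ℝ (Vec d)) (k : Fin d) (x : Vec d) :
    ‖perp (v k) x‖ ^ 2 = ∑ i, if i = k then 0 else inner ℝ (v i) x ^ 2 := by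
  rw [norm_perp_sq (v.norm_eq_one k), ← v.sum_sq_inner_right x, sub_eq_iff_eq_add,
    ← Finset.sum_ite_eq' Finset.univ k (fun i => inner ℝ (v i) x ^ 2) |>.trans
      (if_pos (Finset.mem_univ k)),
    ← Finset.sum_add_distrib]
  refine Finset.sum_congr rfl fun i _ => ?_
  split_ifs <;> simp

lemma IsOrderedEigenbasis.norm_add_smul_matVec_sq_le (h : IsOrderedEigenbasis S lam v)
    (hS : S.PosSemidef) {η l : ℝ} (hη : 0 ≤ η) (hl : ∀ i, lam i ≤ l) (x : Vec d) :
    ‖x + η • matVec S x‖ ^ 2 ≤ (1 + η * l) ^ 2 * ‖x‖ ^ 2 := by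
  rw [← v.sum_sq_inner_right x, ← v.sum_sq_inner_right (x + _), Finset.mul_sum]
  refine Finset.sum_le_sum fun i _ => ?_
  rw [inner_add_right, real_inner_smul_right,
    h.inner_matVec_eq (by simpa using hS.isHermitian.eq)]
  have h1 := h.nonneg hS i
  have h2 : (1 + η * lam i) ^ 2 ≤ (1 + η * l) ^ 2 := by gcongr; exact hl i
  calc _ = (1 + η * lam i) ^ 2 * inner ℝ (v i) x ^ 2 := by ring
    _ ≤ _ := by gcongr

lemma IsOrderedEigenbasis.norm_perp_add_smul_matVec_sq_le (h : IsOrderedEigenbasis S lam v)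
    (hS : S.PosSemidef) {η l : ℝ} (hη : 0 ≤ η) {k : Fin d} (hl : ∀ i, i ≠ k → lam i ≤ l)
    (x : Vec d) :
    ‖perp (v k) (x + η • matVec S x)‖ ^ 2 ≤ (1 + η * l) ^ 2 * ‖perp (v k) x‖ ^ 2 := by
  rw [norm_perp_sq_eq_sum, norm_perp_sq_eq_sum, Finset.mul_sum]
  refine Finset.sum_le_sum fun i _ => ?_
  split_ifs with hi
  · simp
  rw [inner_add_right, real_inner_smul_right,
    h.inner_matVec_eq (by simpa using hS.isHermitian.eq)]
  have h1 := h.nonneg hS i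
  have h2 : (1 + η * lam i) ^ 2 ≤ (1 + η * l) ^ 2 := by gcongr; exact hl i hi
  calc _ = (1 + η * lam i) ^ 2 * inner ℝ (v i) x ^ 2 := by ring
    _ ≤ _ := by gcongr

end Eigenbasis

/-! ### The unnormalized product and peeling off its last factor. -/

section Product

variable {d : ℕ}

/-- The matrix product `(1 + η n A (n - 1)) ⋯ (1 + η 1 A 0)` of the unnormalized iteration. -/
def ojaMat (η : ℕ → ℝ) : (n : ℕ) → (Fin n → Mat d) → Mat d
  | 0, _ => 1
  | n + 1, A => (1 + η (n + 1) • A (Fin.last n)) * ojaMat η n (fun i => A i.castSucc)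

lemma ojaMat_succ_matVec (η : ℕ → ℝ) (n : ℕ) (A : Fin (n + 1) → Mat d) (x : Vec d) :
    matVec (ojaMat η (n + 1) A) x =
      matVec (ojaMat η n fun i => A i.castSucc) x +
        η (n + 1) • matVec (A (Fin.last n)) (matVec (ojaMat η n fun i => A i.castSucc) x) := by
  rw [ojaMat, mul_matVec, add_matVec, one_matVec, smul_matVec]

lemma ojaMat_succ_transpose_matVec (η : ℕ → ℝ) (n : ℕ) (A : Fin (n + 1) → Mat d) (u : Vec d) :
    matVec (ojaMat η (n + 1) A)ᵀ u =
      matVec (ojaMat η n fun i => A i.castSucc)ᵀ (u + η (n + 1) • matVec (A (Fin.last n))ᵀ u) := by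
  rw [ojaMat, Matrix.transpose_mul, mul_matVec, Matrix.transpose_add, add_matVec,
    Matrix.transpose_one, one_matVec, Matrix.transpose_smul, smul_matVec]

@[fun_prop]
lemma continuous_ojaMat (η : ℕ → ℝ) (n : ℕ) :
    Continuous (ojaMat η n : (Fin n → Mat d) → Mat d) := by
  induction n with
  | zero => exact continuous_const
  | succ n ih =>
    have h : Continuous fun A : Fin (n + 1) → Mat d => ojaMat η n fun i => A i.castSucc :=
      ih.comp (by fun_prop)
    exact Continuous.matrix_mul (by fun_prop) h

/-- Each step is positively homogeneous before normalization, so intermediate scalings drop out. A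
nonzero final vector forces all earlier ones to be nonzero, so one hypothesis at time `n` suffices.
-/
lemma ojaOutput_eq (η : ℕ → ℝ) (n : ℕ) (A : Fin n → Mat d) {w : Vec d} (hw : ‖w‖ = 1)
    (h : matVec (ojaMat η n A) w ≠ 0) :
    ojaOutput η n A w = ‖matVec (ojaMat η n A) w‖⁻¹ • matVec (ojaMat η n A) w := by
  induction n with
  | zero => simp [ojaOutput, ojaMat, one_matVec, hw]
  | succ n ih =>
    rw [ojaMat_succ_matVec] at h ⊢
    set y := matVec (ojaMat η n fun i => A i.castSucc) w with hy
    have hy0 : y ≠ 0 := by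
      intro h0
      rw [h0] at h
      exact h (by simp [matVec])
    have hpos : 0 < ‖y‖⁻¹ := inv_pos.2 (norm_pos_iff.2 hy0)
    rw [ojaOutput, ih _ hy0, ← hy, ojaStep, matVec_smul, smul_comm (η (n + 1)), ← smul_add,
      norm_smul, Real.norm_of_nonneg hpos.le, smul_smul]
    congr 1
    field_simp

lemma measurable_ofReal_of_continuous {X : Type*} [TopologicalSpace X] [MeasurableSpace X]
    [OpensMeasurableSpace X] {f : X → ℝ} (hf : Continuous f) :
    Measurable fun x => ENNReal.ofReal (f x) :=
  hf.measurable.ennreal_ofReal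

lemma lintegral_pi_last {n : ℕ} {X : Type*} [MeasurableSpace X] (μ : Fin (n + 1) → Measure X)
    [∀ i, IsProbabilityMeasure (μ i)] {F : X → (Fin n → X) → ℝ≥0∞}
    (hF : Measurable fun p : X × (Fin n → X) => F p.1 p.2) :
    ∫⁻ A, F (A (Fin.last n)) (fun i => A i.castSucc) ∂Measure.pi μ =
      ∫⁻ B, ∫⁻ a, F a B ∂μ (Fin.last n) ∂Measure.pi fun i => μ i.castSucc := by
  have h := (measurePreserving_piFinSuccAbove μ (Fin.last n)).lintegral_comp hF
  simp only [Fin.succAbove_last] at h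
  rw [← lintegral_prod_symm _ hF.aemeasurable, ← h]
  refine lintegral_congr fun A => ?_
  congr 1
  funext i
  simp [MeasurableEquiv.piFinSuccAbove, Fin.init]

end Product

/-! ### Moment recursions for one step and for the product. -/

section ProductMoments

variable {d : ℕ} {S : Mat d} {M V : ℝ} {lam : Fin d → ℝ} {v : OrthonormalBasis (Fin d) ℝ (Vec d)}

/-- The second-moment growth `∏ ((1 + η l)² + η² V)`. -/
def momentGrowth (η : ℕ → ℝ) (l V : ℝ) (n : ℕ) : ℝ :=
  ∏ i ∈ Finset.range n, ((1 + η (i + 1) * l) ^ 2 + η (i + 1) ^ 2 * V)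

/-- The first-moment growth `∏ (1 + η l)`. -/
def meanGrowth (η : ℕ → ℝ) (l : ℝ) (n : ℕ) : ℝ :=
  ∏ i ∈ Finset.range n, (1 + η (i + 1) * l)

lemma momentGrowth_nonneg (η : ℕ → ℝ) (l : ℝ) {V : ℝ} (hV : 0 ≤ V) (n : ℕ) :
    0 ≤ momentGrowth η l V n :=
  Finset.prod_nonneg fun _ _ => by positivity

lemma momentGrowth_succ (η : ℕ → ℝ) (l V : ℝ) (n : ℕ) : momentGrowth η l V (n + 1) =
    momentGrowth η l V n * ((1 + η (n + 1) * l) ^ 2 + η (n + 1) ^ 2 * V) :=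
  Finset.prod_range_succ _ _

lemma meanGrowth_succ (η : ℕ → ℝ) (l : ℝ) (n : ℕ) : meanGrowth η l (n + 1) =
    meanGrowth η l n * (1 + η (n + 1) * l) :=
  Finset.prod_range_succ _ _

lemma meanGrowth_pos {η : ℕ → ℝ} {l : ℝ} (hη : ∀ i, 0 ≤ η i) (hl : 0 ≤ l) (n : ℕ) :
    0 < meanGrowth η l n :=
  Finset.prod_pos fun i _ => by have := mul_nonneg (hη (i + 1)) hl; positivity

/-- Splitting `x + η A x` into its mean and its fluctuation. -/
lemma add_smul_matVec_eq (A S : Mat d) (η : ℝ) (x : Vec d) :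
    x + η • matVec A x = (x + η • matVec S x) + η • matVec (A - S) x := by
  rw [sub_matVec, smul_sub]; abel

section Step

variable {μ : Measure (Mat d)} [IsProbabilityMeasure μ]

lemma lintegral_norm_step_sq_le (hE : IsOrderedEigenbasis S lam v) (hS : S.PosSemidef)
    (hμ : IsCentredNoise μ (fun A => A - S) M V) {l η : ℝ} (hl : ∀ i, lam i ≤ l) (hη : 0 ≤ η)
    (x : Vec d) :
    ∫⁻ A, ENNReal.ofReal (‖x + η • matVec A x‖ ^ 2) ∂μ ≤
      ENNReal.ofReal (((1 + η * l) ^ 2 + η ^ 2 * V) * ‖x‖ ^ 2) := by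
  have h := hμ.lintegral_norm_add_sq_le (η • ContinuousLinearMap.id ℝ (Vec d)) (sq_nonneg η)
    (fun y => by simp [norm_smul, mul_pow]) (x + η • matVec S x) x
  refine (lintegral_mono fun A => ?_).trans (h.trans ?_)
  · rw [add_smul_matVec_eq _ S]
    rfl
  refine (ENNReal.ofReal_le_ofReal ?_)
  linarith [hE.norm_add_smul_matVec_sq_le hS hη hl x]

lemma lintegral_norm_step_transpose_sq_le (hE : IsOrderedEigenbasis S lam v) (hS : S.PosSemidef)
    (hμ : IsCentredNoise μ (fun A => (A - S)ᵀ) M V) {l η : ℝ} (hl : ∀ i, lam i ≤ l) (hη : 0 ≤ η)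
    (x : Vec d) :
    ∫⁻ A, ENNReal.ofReal (‖x + η • matVec Aᵀ x‖ ^ 2) ∂μ ≤
      ENNReal.ofReal (((1 + η * l) ^ 2 + η ^ 2 * V) * ‖x‖ ^ 2) := by
  have h := hμ.lintegral_norm_add_sq_le (η • ContinuousLinearMap.id ℝ (Vec d)) (sq_nonneg η)
    (fun y => by simp [norm_smul, mul_pow]) (x + η • matVec S x) x
  have hST : Sᵀ = S := by simpa using hS.isHermitian.eq
  simp only [Matrix.transpose_sub, hST] at h
  refine (lintegral_mono fun A => ?_).trans (h.trans ?_)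
  · rw [add_smul_matVec_eq _ S]
    rfl
  refine (ENNReal.ofReal_le_ofReal ?_)
  linarith [hE.norm_add_smul_matVec_sq_le hS hη hl x]

/-- The mean step preserves the complement of `v k`, but the noise acts on all of `x`; the component
along `v k` therefore leaks in through the last term. -/
lemma lintegral_norm_perp_step_sq_le (hE : IsOrderedEigenbasis S lam v) (hS : S.PosSemidef)
    (hμ : IsCentredNoise μ (fun A => A - S) M V) {k : Fin d} {l η : ℝ}
    (hl : ∀ i, i ≠ k → lam i ≤ l) (hη : 0 ≤ η) (x : Vec d) :
    ∫⁻ A, ENNReal.ofReal (‖perp (v k) (x + η • matVec A x)‖ ^ 2) ∂μ ≤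
      ENNReal.ofReal (((1 + η * l) ^ 2 + η ^ 2 * V) * ‖perp (v k) x‖ ^ 2 +
        η ^ 2 * V * inner ℝ (v k) x ^ 2) := by
  have hp := norm_perp_sq (v.norm_eq_one k)
  have h := hμ.lintegral_norm_add_sq_le (η • perp (v k)) (sq_nonneg η)
    (fun y => by
      rw [smul_apply, norm_smul, mul_pow, hp]
      simp only [Real.norm_eq_abs, sq_abs]
      nlinarith [sq_nonneg η, sq_nonneg (inner ℝ (v k) y),
        mul_nonneg (sq_nonneg η) (sq_nonneg (inner ℝ (v k) y))])
    (perp (v k) (x + η • matVec S x)) x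
  have heq : ∀ A, perp (v k) (x + η • matVec A x) =
      perp (v k) (x + η • matVec S x) + (η • perp (v k)) (matVec (A - S) x) := by
    intro A
    rw [add_smul_matVec_eq A S, map_add, map_smul, smul_apply]
  refine (lintegral_mono fun A => by rw [heq A]).trans (h.trans ?_)
  refine (ENNReal.ofReal_le_ofReal ?_)
  have h1 := hE.norm_perp_add_smul_matVec_sq_le hS hη hl x
  have h2 : ‖x‖ ^ 2 = ‖perp (v k) x‖ ^ 2 + inner ℝ (v k) x ^ 2 := by rw [hp]; ring
  rw [h2]
  linarith

lemma lintegral_inner_step_sub_sq_le (hE : IsOrderedEigenbasis S lam v) (hS : S.PosSemidef)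
    (hμ : IsCentredNoise μ (fun A => A - S) M V) (k : Fin d) (η a : ℝ) (x : Vec d) :
    ∫⁻ A, ENNReal.ofReal ((inner ℝ (v k) (x + η • matVec A x) - a) ^ 2) ∂μ ≤
      ENNReal.ofReal (((1 + η * lam k) * inner ℝ (v k) x - a) ^ 2 + η ^ 2 * V * ‖x‖ ^ 2) := by
  have h := hμ.lintegral_norm_add_sq_le (η • innerSL ℝ (v k)) (sq_nonneg η)
    (fun y => by
      rw [smul_apply, norm_smul, mul_pow, innerSL_apply_apply]
      simp only [Real.norm_eq_abs, sq_abs]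
      have := abs_real_inner_le_norm (v k) y
      rw [v.norm_eq_one, one_mul] at this
      have h2 := sq_le_sq' (by linarith [neg_abs_le (inner ℝ (v k) y)]) ((le_abs_self _).trans this)
      gcongr)
    ((1 + η * lam k) * inner ℝ (v k) x - a) x
  have heq : ∀ A, inner ℝ (v k) (x + η • matVec A x) - a =
      ((1 + η * lam k) * inner ℝ (v k) x - a) + (η • innerSL ℝ (v k)) (matVec (A - S) x) := by
    intro A
    rw [add_smul_matVec_eq A S, inner_add_right, inner_add_right, real_inner_smul_right,
      hE.inner_matVec_eq (by simpa using hS.isHermitian.eq), real_inner_smul_right,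
      smul_apply, innerSL_apply_apply, smul_eq_mul]
    ring
  simp only [Real.norm_eq_abs, sq_abs] at h
  refine (lintegral_mono fun A => by rw [heq A]).trans (h.trans ?_)
  refine (ENNReal.ofReal_le_ofReal (le_of_eq ?_))
  ring

end Step

variable {n : ℕ} {μ : Fin n → Measure (Mat d)} [∀ i, IsProbabilityMeasure (μ i)] {η : ℕ → ℝ}

lemma lintegral_norm_ojaMat_sq_le (hE : IsOrderedEigenbasis S lam v) (hS : S.PosSemidef)
    (hV : 0 ≤ V) (hμ : ∀ i, IsCentredNoise (μ i) (fun A => A - S) M V) {l : ℝ}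
    (hl : ∀ i, lam i ≤ l) (hη : ∀ i, 0 ≤ η i) (x : Vec d) :
    ∫⁻ A, ENNReal.ofReal (‖matVec (ojaMat η n A) x‖ ^ 2) ∂Measure.pi μ ≤
      ENNReal.ofReal (momentGrowth η l V n * ‖x‖ ^ 2) := by
  induction n with
  | zero => simp [ojaMat, one_matVec, momentGrowth]
  | succ n ih =>
    simp only [ojaMat_succ_matVec]
    rw [lintegral_pi_last μ (F := fun a B => ENNReal.ofReal (‖matVec (ojaMat η n B) x +
      η (n + 1) • matVec a (matVec (ojaMat η n B) x)‖ ^ 2))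
      (measurable_ofReal_of_continuous (by fun_prop))]
    have hq : 0 ≤ (1 + η (n + 1) * l) ^ 2 + η (n + 1) ^ 2 * V := by positivity
    calc _ ≤ ∫⁻ B, ENNReal.ofReal ((1 + η (n + 1) * l) ^ 2 + η (n + 1) ^ 2 * V) *
          ENNReal.ofReal (‖matVec (ojaMat η n B) x‖ ^ 2) ∂Measure.pi fun i => μ i.castSucc := by
          refine lintegral_mono fun B => ?_
          rw [← ENNReal.ofReal_mul hq]
          exact lintegral_norm_step_sq_le hE hS (hμ _) hl (hη _) _
      _ ≤ ENNReal.ofReal ((1 + η (n + 1) * l) ^ 2 + η (n + 1) ^ 2 * V) *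
          ENNReal.ofReal (momentGrowth η l V n * ‖x‖ ^ 2) := by
          rw [lintegral_const_mul _ (measurable_ofReal_of_continuous (by fun_prop))]
          gcongr
          exact ih fun i => hμ i.castSucc
      _ = _ := by
          rw [← ENNReal.ofReal_mul hq, momentGrowth_succ]
          congr 1; ring

lemma lintegral_norm_ojaMat_transpose_sq_le (hE : IsOrderedEigenbasis S lam v)
    (hS : S.PosSemidef) (hV : 0 ≤ V) (hμ : ∀ i, IsCentredNoise (μ i) (fun A => (A - S)ᵀ) M V)
    {l : ℝ} (hl : ∀ i, lam i ≤ l) (hη : ∀ i, 0 ≤ η i) (u : Vec d) :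
    ∫⁻ A, ENNReal.ofReal (‖matVec (ojaMat η n A)ᵀ u‖ ^ 2) ∂Measure.pi μ ≤
      ENNReal.ofReal (momentGrowth η l V n * ‖u‖ ^ 2) := by
  induction n generalizing u with
  | zero => simp [ojaMat, one_matVec, momentGrowth]
  | succ n ih =>
    simp only [ojaMat_succ_transpose_matVec]
    have hm : Measurable fun p : Mat d × (Fin n → Mat d) =>
        ENNReal.ofReal (‖matVec (ojaMat η n p.2)ᵀ (u + η (n + 1) • matVec p.1ᵀ u)‖ ^ 2) := by
      exact measurable_ofReal_of_continuous (by fun_prop)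
    -- In the transposed product the last sample acts first on `u`. The earlier factors are
    -- therefore integrated first, with `a` fixed, and the induction hypothesis is used at a vector
    -- depending on `a`.
    rw [lintegral_pi_last μ (F := fun a B => ENNReal.ofReal (‖matVec (ojaMat η n B)ᵀ (u +
      η (n + 1) • matVec aᵀ u)‖ ^ 2)) hm,
      lintegral_lintegral_swap (f := fun (B : Fin n → Mat d) (a : Mat d) => ENNReal.ofReal
        (‖matVec (ojaMat η n B)ᵀ (u + η (n + 1) • matVec aᵀ u)‖ ^ 2))
        (hm.comp measurable_swap).aemeasurable]
    have hG := momentGrowth_nonneg η l hV n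
    calc _ ≤ ∫⁻ a, ENNReal.ofReal (momentGrowth η l V n) *
          ENNReal.ofReal (‖u + η (n + 1) • matVec aᵀ u‖ ^ 2) ∂μ (Fin.last n) := by
          refine lintegral_mono fun a => ?_
          rw [← ENNReal.ofReal_mul hG]
          exact ih (fun i => hμ i.castSucc) _
      _ ≤ ENNReal.ofReal (momentGrowth η l V n) *
          ENNReal.ofReal (((1 + η (n + 1) * l) ^ 2 + η (n + 1) ^ 2 * V) * ‖u‖ ^ 2) := by
          rw [lintegral_const_mul _ (measurable_ofReal_of_continuous (by fun_prop))]
          gcongr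
          exact lintegral_norm_step_transpose_sq_le hE hS (hμ _) hl (hη _) _
      _ = _ := by
          rw [← ENNReal.ofReal_mul hG, momentGrowth_succ]
          congr 1; ring

/-- The normalized coordinate is a martingale started at 1, so its variance is the sum of those of
its increments. The increment at step `i + 1` has variance at most `η² V ‖B v k‖² / meanGrowth²`,
with `B` the product of the first `i` factors. -/
lemma lintegral_inner_ojaMat_sub_sq_le (hE : IsOrderedEigenbasis S lam v) (hS : S.PosSemidef)
    (hV : 0 ≤ V) (hμ : ∀ i, IsCentredNoise (μ i) (fun A => A - S) M V) (k : Fin d)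
    (hl : ∀ i, lam i ≤ lam k) (hη : ∀ i, 0 ≤ η i) :
    ∫⁻ A, ENNReal.ofReal ((inner ℝ (v k) (matVec (ojaMat η n A) (v k)) /
        meanGrowth η (lam k) n - 1) ^ 2) ∂Measure.pi μ ≤
      ENNReal.ofReal (∑ i ∈ Finset.range n, η (i + 1) ^ 2 * V *
        (momentGrowth η (lam k) V i / meanGrowth η (lam k) (i + 1) ^ 2)) := by
  induction n with
  | zero => simp [ojaMat, one_matVec, meanGrowth]
  | succ n ih =>
    have hlk := hE.nonneg hS k
    have hP := meanGrowth_pos hη hlk (n + 1)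
    set P := meanGrowth η (lam k) (n + 1) with hPdef
    have hq : 0 ≤ η (n + 1) ^ 2 * V / P ^ 2 := by positivity
    have hone : 0 < 1 + η (n + 1) * lam k := by have := mul_nonneg (hη (n + 1)) hlk; positivity
    simp only [ojaMat_succ_matVec]
    rw [lintegral_pi_last μ (F := fun a B => ENNReal.ofReal ((inner ℝ (v k) (matVec (ojaMat η n B)
      (v k) + η (n + 1) • matVec a (matVec (ojaMat η n B) (v k))) / P - 1) ^ 2))
      (measurable_ofReal_of_continuous (by fun_prop (disch := exact hP.ne')))]
    have hstep : ∀ B : Fin n → Mat d, ∫⁻ a, ENNReal.ofReal ((inner ℝ (v k) (matVec (ojaMat η n B)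
        (v k) + η (n + 1) • matVec a (matVec (ojaMat η n B) (v k))) / P - 1) ^ 2)
          ∂μ (Fin.last n) ≤
        ENNReal.ofReal ((inner ℝ (v k) (matVec (ojaMat η n B) (v k)) /
          meanGrowth η (lam k) n - 1) ^ 2) +
        ENNReal.ofReal (η (n + 1) ^ 2 * V / P ^ 2) *
          ENNReal.ofReal (‖matVec (ojaMat η n B) (v k)‖ ^ 2) := by
      intro B
      set x := matVec (ojaMat η n B) (v k)
      have h := lintegral_inner_step_sub_sq_le hE hS (hμ (Fin.last n)) k (η (n + 1)) P x
      have hrw : ∀ a : Mat d, ENNReal.ofReal ((inner ℝ (v k) (x + η (n + 1) • matVec a x) / P - 1) ^ 2)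
          = ENNReal.ofReal ((P ^ 2)⁻¹) *
            ENNReal.ofReal ((inner ℝ (v k) (x + η (n + 1) • matVec a x) - P) ^ 2) := by
        intro a
        rw [← ENNReal.ofReal_mul (by positivity)]
        congr 1
        field_simp
      simp only [hrw]
      rw [lintegral_const_mul _ (measurable_ofReal_of_continuous (by fun_prop)), ← ENNReal.ofReal_mul hq,
        ← ENNReal.ofReal_add (sq_nonneg _) (by positivity)]
      refine (mul_le_mul_right h _).trans (le_of_eq ?_)
      rw [← ENNReal.ofReal_mul (by positivity), hPdef, meanGrowth_succ]
      have := meanGrowth_pos hη hlk n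
      congr 1
      field_simp
    calc _ ≤ _ := lintegral_mono hstep
      _ = _ := lintegral_add_left (measurable_ofReal_of_continuous (by
          have := (meanGrowth_pos hη hlk n).ne'
          fun_prop (disch := exact this))) _
      _ ≤ ENNReal.ofReal (∑ i ∈ Finset.range n, η (i + 1) ^ 2 * V *
            (momentGrowth η (lam k) V i / meanGrowth η (lam k) (i + 1) ^ 2)) +
          ENNReal.ofReal (η (n + 1) ^ 2 * V / P ^ 2) *
            ENNReal.ofReal (momentGrowth η (lam k) V n * ‖v k‖ ^ 2) := by
          rw [lintegral_const_mul _ (measurable_ofReal_of_continuous (by fun_prop))]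
          gcongr
          · exact ih fun i => hμ i.castSucc
          · exact lintegral_norm_ojaMat_sq_le hE hS hV (fun i => hμ i.castSucc) hl hη _
      _ = _ := by
          rw [← ENNReal.ofReal_mul hq, ← ENNReal.ofReal_add, Finset.sum_range_succ,
            v.norm_eq_one]
          · congr 2
            ring
          · refine Finset.sum_nonneg fun i _ => ?_
            have := momentGrowth_nonneg η (lam k) hV i
            positivity
          · have := momentGrowth_nonneg η (lam k) hV n
            positivity

/-- The recursive bound on the expected squared Frobenius norm of `perp (v k) * ojaMat η n A`. -/
def residualBound (η : ℕ → ℝ) (d : ℕ) (l₁ l₂ V : ℝ) : ℕ → ℝ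
  | 0 => d
  | n + 1 => ((1 + η (n + 1) * l₂) ^ 2 + η (n + 1) ^ 2 * V) * residualBound η d l₁ l₂ V n +
      η (n + 1) ^ 2 * V * momentGrowth η l₁ V n

lemma residualBound_nonneg (η : ℕ → ℝ) (d : ℕ) (l₁ l₂ : ℝ) {V : ℝ} (hV : 0 ≤ V) (n : ℕ) :
    0 ≤ residualBound η d l₁ l₂ V n := by
  induction n with
  | zero => simp [residualBound]
  | succ n ih =>
    have := momentGrowth_nonneg η l₁ hV n
    rw [residualBound]
    positivity

/-- Summing the one-step bound over the basis, the leakage terms `⟨v k, B v j⟩²` add up to `‖Bᵀ (v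
k)‖²`. This is where the transposed moment bound, which carries no factor `d`, enters. -/
lemma lintegral_perp_ojaMat_le (hE : IsOrderedEigenbasis S lam v) (hS : S.PosSemidef)
    (hV : 0 ≤ V) (hμ : ∀ i, IsCentredNoise (μ i) (fun A => A - S) M V)
    (hμ' : ∀ i, IsCentredNoise (μ i) (fun A => (A - S)ᵀ) M V) (k : Fin d) {l₁ l₂ : ℝ}
    (hl₁ : ∀ i, lam i ≤ l₁) (hl₂ : ∀ i, i ≠ k → lam i ≤ l₂) (hη : ∀ i, 0 ≤ η i) :
    ∫⁻ A, ENNReal.ofReal (∑ j, ‖perp (v k) (matVec (ojaMat η n A) (v j))‖ ^ 2) ∂Measure.pi μ ≤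
      ENNReal.ofReal (residualBound η d l₁ l₂ V n) := by
  induction n with
  | zero =>
    simp only [ojaMat, one_matVec, residualBound, lintegral_const, measure_univ, mul_one]
    refine ENNReal.ofReal_le_ofReal ?_
    calc _ ≤ ∑ j : Fin d, (1 : ℝ) := by
          refine Finset.sum_le_sum fun j _ => ?_
          rw [norm_perp_sq (v.norm_eq_one k), v.norm_eq_one]
          nlinarith [sq_nonneg (inner ℝ (v k) (v j))]
      _ = d := by simp
  | succ n ih =>
    set q := (1 + η (n + 1) * l₂) ^ 2 + η (n + 1) ^ 2 * V with hqdef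
    have hq : 0 ≤ q := by positivity
    have hr : 0 ≤ η (n + 1) ^ 2 * V := by positivity
    simp only [ojaMat_succ_matVec]
    rw [lintegral_pi_last μ (F := fun a B => ENNReal.ofReal (∑ j, ‖perp (v k) (matVec (ojaMat η n B)
      (v j) + η (n + 1) • matVec a (matVec (ojaMat η n B) (v j)))‖ ^ 2))
      (measurable_ofReal_of_continuous (by fun_prop))]
    have hstep : ∀ B : Fin n → Mat d, ∫⁻ a, ENNReal.ofReal (∑ j, ‖perp (v k) (matVec (ojaMat η n B)
        (v j) + η (n + 1) • matVec a (matVec (ojaMat η n B) (v j)))‖ ^ 2) ∂μ (Fin.last n) ≤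
        ENNReal.ofReal q *
          ENNReal.ofReal (∑ j, ‖perp (v k) (matVec (ojaMat η n B) (v j))‖ ^ 2) +
        ENNReal.ofReal (η (n + 1) ^ 2 * V) *
          ENNReal.ofReal (‖matVec (ojaMat η n B)ᵀ (v k)‖ ^ 2) := by
      intro B
      have h1 : ∑ j, inner ℝ (v k) (matVec (ojaMat η n B) (v j)) ^ 2 =
          ‖matVec (ojaMat η n B)ᵀ (v k)‖ ^ 2 := by
        rw [← v.sum_sq_inner_left (matVec (ojaMat η n B)ᵀ (v k))]
        simp only [inner_matVec_transpose]
      have h2 : ∀ a : Mat d, ENNReal.ofReal (∑ j, ‖perp (v k) (matVec (ojaMat η n B) (v j) +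
          η (n + 1) • matVec a (matVec (ojaMat η n B) (v j)))‖ ^ 2) =
          ∑ j, ENNReal.ofReal (‖perp (v k) (matVec (ojaMat η n B) (v j) +
          η (n + 1) • matVec a (matVec (ojaMat η n B) (v j)))‖ ^ 2) := fun a =>
        ENNReal.ofReal_sum_of_nonneg fun j _ => sq_nonneg _
      rw [lintegral_congr h2,
        lintegral_finsetSum _ (fun j _ => measurable_ofReal_of_continuous (by fun_prop)),
        ← h1, ← ENNReal.ofReal_mul hq, ← ENNReal.ofReal_mul hr, ← ENNReal.ofReal_add
        (mul_nonneg hq (Finset.sum_nonneg fun j _ => sq_nonneg _))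
        (mul_nonneg hr (Finset.sum_nonneg fun j _ => sq_nonneg _)),
        Finset.mul_sum, Finset.mul_sum, ← Finset.sum_add_distrib,
        ENNReal.ofReal_sum_of_nonneg (fun j _ => add_nonneg (mul_nonneg hq (sq_nonneg _))
          (mul_nonneg hr (sq_nonneg _)))]
      exact Finset.sum_le_sum fun j _ =>
        lintegral_norm_perp_step_sq_le hE hS (hμ (Fin.last n)) hl₂ (hη (n + 1)) _
    refine (lintegral_mono hstep).trans ?_
    rw [lintegral_add_left ((measurable_ofReal_of_continuous (by fun_prop)).const_mul _)]
    calc _ ≤ ENNReal.ofReal q * ENNReal.ofReal (residualBound η d l₁ l₂ V n) +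
          ENNReal.ofReal (η (n + 1) ^ 2 * V) *
            ENNReal.ofReal (momentGrowth η l₁ V n * ‖v k‖ ^ 2) := by
          rw [lintegral_const_mul _ (measurable_ofReal_of_continuous (by fun_prop)),
            lintegral_const_mul _ (measurable_ofReal_of_continuous (by fun_prop))]
          gcongr
          · exact ih (fun i => hμ i.castSucc) fun i => hμ' i.castSucc
          · exact lintegral_norm_ojaMat_transpose_sq_le hE hS hV (fun i => hμ' i.castSucc) hl₁ hη _
      _ = _ := by
          have := momentGrowth_nonneg η l₁ hV n
          have := residualBound_nonneg η d l₁ l₂ hV n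
          rw [← ENNReal.ofReal_mul hq, ← ENNReal.ofReal_mul hr, ← ENNReal.ofReal_add
            (by positivity) (by positivity), v.norm_eq_one, residualBound]
          congr 1
          ring

end ProductMoments

/-! ### Deterministic estimates for the harmonic step sizes. -/

section Scalar

/-- The step sizes `L / (g (β + i))`. -/
def harmonicStep (L g β : ℝ) (i : ℕ) : ℝ := L / (g * (β + i))

lemma sum_inv_sq_le {β : ℝ} (hβ : 0 < β) (n : ℕ) :
    ∑ i ∈ Finset.range n, 1 / (β + (i + 1 : ℕ)) ^ 2 ≤ 1 / β - 1 / (β + n) := by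
  induction n with
  | zero => simp
  | succ n ih =>
    rw [Finset.sum_range_succ]
    have h : 1 / (β + (n + 1 : ℕ)) ^ 2 ≤ 1 / (β + n) - 1 / (β + (n + 1 : ℕ)) := by
      push_cast
      rw [div_sub_div _ _ (by positivity) (by positivity), div_le_div_iff₀ (by positivity)
        (by positivity)]
      have : 0 ≤ β + n := by positivity
      nlinarith
    linarith

/-- The accumulated variance of the step sizes. -/
def varianceSum (η : ℕ → ℝ) (W : ℝ) (n : ℕ) : ℝ := ∑ i ∈ Finset.range n, η (i + 1) ^ 2 * W

lemma varianceSum_succ (η : ℕ → ℝ) (W : ℝ) (n : ℕ) :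
    varianceSum η W (n + 1) = varianceSum η W n + η (n + 1) ^ 2 * W :=
  Finset.sum_range_succ _ _

lemma varianceSum_nonneg (η : ℕ → ℝ) {W : ℝ} (hW : 0 ≤ W) (n : ℕ) : 0 ≤ varianceSum η W n :=
  Finset.sum_nonneg fun _ _ => by positivity

lemma varianceSum_harmonicStep_le {L g β W : ℝ} (hg : 0 < g) (hβ : 0 < β) (hW : 0 ≤ W)
    (h : 40 * (W * L ^ 2 / g ^ 2) ≤ β) (n : ℕ) :
    varianceSum (harmonicStep L g β) W n ≤ 1 / 40 := by
  have h1 : varianceSum (harmonicStep L g β) W n =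
      W * L ^ 2 / g ^ 2 * ∑ i ∈ Finset.range n, 1 / (β + (i + 1 : ℕ)) ^ 2 := by
    rw [varianceSum, Finset.mul_sum]
    refine Finset.sum_congr rfl fun i _ => ?_
    rw [harmonicStep]
    have : β + (i + 1 : ℕ) ≠ 0 := by positivity
    field_simp
  have h2 : ∑ i ∈ Finset.range n, 1 / (β + (i + 1 : ℕ)) ^ 2 ≤ 1 / β := by
    have := sum_inv_sq_le hβ n
    have : 0 ≤ 1 / (β + n) := by positivity
    linarith
  rw [h1]
  calc _ ≤ W * L ^ 2 / g ^ 2 * (1 / β) := by gcongr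
    _ ≤ 1 / 40 := by
      rw [mul_one_div, div_le_div_iff₀ hβ (by norm_num)]
      linarith

lemma momentGrowth_le {η : ℕ → ℝ} {l V W : ℝ} (hη : ∀ i, 0 ≤ η i) (hl : 0 ≤ l) (hV : 0 ≤ V)
    (hVW : V ≤ W) (n : ℕ) :
    momentGrowth η l V n ≤ meanGrowth η l n ^ 2 * Real.exp (varianceSum η W n) := by
  induction n with
  | zero => simp [momentGrowth, meanGrowth, varianceSum]
  | succ n ih =>
    have hG := momentGrowth_nonneg η l hV n
    have h0 := mul_nonneg (hη (n + 1)) hl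
    have hq : 0 ≤ η (n + 1) ^ 2 * V := by positivity
    rw [momentGrowth_succ, meanGrowth_succ, varianceSum_succ, Real.exp_add, mul_pow]
    have h1 : (1 + η (n + 1) * l) ^ 2 + η (n + 1) ^ 2 * V ≤
        (1 + η (n + 1) * l) ^ 2 * Real.exp (η (n + 1) ^ 2 * W) := by
      have h2 : 1 + η (n + 1) ^ 2 * V ≤ Real.exp (η (n + 1) ^ 2 * W) := by
        calc _ ≤ η (n + 1) ^ 2 * W + 1 := by rw [add_comm]; gcongr
          _ ≤ _ := Real.add_one_le_exp _
      have h3 : 1 ≤ (1 + η (n + 1) * l) ^ 2 := one_le_pow₀ (by linarith)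
      calc _ ≤ (1 + η (n + 1) * l) ^ 2 * (1 + η (n + 1) ^ 2 * V) := by nlinarith
        _ ≤ _ := by gcongr
    calc _ ≤ _ := mul_le_mul ih h1 (by positivity) (by positivity)
      _ = _ := by ring

lemma sum_variance_mul_ratio_le {η : ℕ → ℝ} {l V W : ℝ} (hη : ∀ i, 0 ≤ η i) (hl : 0 ≤ l)
    (hV : 0 ≤ V) (hVW : V ≤ W) (hsum : ∀ n, varianceSum η W n ≤ 1 / 40) (n : ℕ) :
    ∑ i ∈ Finset.range n, η (i + 1) ^ 2 * V *
      (momentGrowth η l V i / meanGrowth η l (i + 1) ^ 2) ≤ 13 / 500 := by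
  -- The bound is 1.04; the factor 40 cancels the `1/40` from `hsum`.
  have hexp : Real.exp (1 / 40) ≤ 13 / 500 * 40 := by
    have h := Real.exp_bound' (x := 1 / 40) (by norm_num) (by norm_num) (n := 2) (by norm_num)
    norm_num [Finset.sum_range_succ] at h
    norm_num
    linarith
  have hratio : ∀ i, momentGrowth η l V i / meanGrowth η l (i + 1) ^ 2 ≤ Real.exp (1 / 40) := by
    intro i
    have hP := meanGrowth_pos hη hl i
    have hP' := meanGrowth_pos hη hl (i + 1)
    have h0 := mul_nonneg (hη (i + 1)) hl
    have hle : meanGrowth η l i ≤ meanGrowth η l (i + 1) := by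
      rw [meanGrowth_succ]; nlinarith
    rw [div_le_iff₀ (by positivity), mul_comm]
    refine (momentGrowth_le hη hl hV hVW i).trans ?_
    gcongr
    exact hsum i
  have hVs : ∑ i ∈ Finset.range n, η (i + 1) ^ 2 * V ≤ 1 / 40 :=
    (Finset.sum_le_sum fun i _ => by gcongr).trans (hsum n)
  calc _ ≤ ∑ i ∈ Finset.range n, η (i + 1) ^ 2 * V * Real.exp (1 / 40) :=
        Finset.sum_le_sum fun i _ => by gcongr; exact hratio i
    _ = (∑ i ∈ Finset.range n, η (i + 1) ^ 2 * V) * Real.exp (1 / 40) := by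
        rw [Finset.sum_mul]
    _ ≤ 1 / 40 * (13 / 500 * 40) := by gcongr
    _ = _ := by norm_num

/-- To first order `1 + η l₂` is `(1 + η l₁) exp (-η (l₁ - l₂))`; the second-order error is absorbed
by `exp (η² l₁²)`. This accounts for the `l₁²` next to `V` in `β`. -/
lemma residual_factor_le {η l₁ l₂ V : ℝ} (hη : 0 ≤ η) (hl₂ : 0 ≤ l₂) (hl : l₂ ≤ l₁)
    (hV : 0 ≤ V) :
    (1 + η * l₂) ^ 2 + η ^ 2 * V ≤ (1 + η * l₁) ^ 2 *
      (Real.exp (2 * (η ^ 2 * (V + l₁ ^ 2))) * Real.exp (-2 * (η * (l₁ - l₂)))) := by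
  have hl₁ : 0 ≤ l₁ := hl₂.trans hl
  have h1 : 1 + η * l₂ ≤ (1 + η * l₁) * Real.exp (-(η * (l₁ - l₂)) + η ^ 2 * l₁ ^ 2) := by
    have hb : -(η * (l₁ - l₂)) + η ^ 2 * l₁ ^ 2 + 1 ≤
      Real.exp (-(η * (l₁ - l₂)) + η ^ 2 * l₁ ^ 2) := Real.add_one_le_exp _
    refine le_trans ?_ (mul_le_mul_of_nonneg_left hb (by positivity))
    nlinarith [mul_nonneg (mul_nonneg hη hη) (mul_nonneg hl₁ hl₂),
      mul_nonneg (pow_nonneg hη 3) (pow_nonneg hl₁ 3)]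
  have h2 : 1 + η ^ 2 * V ≤ Real.exp (2 * (η ^ 2 * V)) := by
    have := Real.add_one_le_exp (2 * (η ^ 2 * V))
    have : 0 ≤ η ^ 2 * V := by positivity
    linarith
  have h3 : 1 ≤ (1 + η * l₂) ^ 2 := one_le_pow₀ (by nlinarith)
  have h4 : 0 ≤ η ^ 2 * V := by positivity
  calc _ ≤ (1 + η * l₂) ^ 2 * (1 + η ^ 2 * V) := by nlinarith
    _ ≤ ((1 + η * l₁) * Real.exp (-(η * (l₁ - l₂)) + η ^ 2 * l₁ ^ 2)) ^ 2 *
        Real.exp (2 * (η ^ 2 * V)) := by gcongr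
    _ = _ := by
      rw [mul_pow, ← Real.exp_nat_mul, mul_assoc, ← Real.exp_add, ← Real.exp_add]
      congr 2
      push_cast
      ring

/-- The power `(s/t) ^ (2L)` is a supersolution of the homogeneous recursion, since `log ((t + 1)/t)
≤ 1/t`. -/
lemma exp_neg_mul_rpow_le {L t s : ℝ} (hL : 0 ≤ L) (ht : 0 < t) (hs : 0 < s) :
    Real.exp (-2 * (L / t)) * (s / t) ^ (2 * L) ≤ (s / (t + 1)) ^ (2 * L) := by
  have h1 : Real.log ((t + 1) / t) ≤ 1 / t := by
    refine (Real.log_le_sub_one_of_pos (by positivity)).trans (le_of_eq ?_)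
    field_simp
    ring
  have h2 : s / t = s / (t + 1) * ((t + 1) / t) := by field_simp
  have h4 : 0 ≤ s / (t + 1) := by positivity
  have h5 : 0 ≤ (t + 1) / t := by positivity
  rw [h2, Real.mul_rpow h4 h5, mul_left_comm,
    Real.rpow_def_of_pos (x := (t + 1) / t) (by positivity), ← Real.exp_add]
  refine mul_le_of_le_one_right (Real.rpow_nonneg h4 _) (Real.exp_le_one_iff.2 ?_)
  have : Real.log ((t + 1) / t) * (2 * L) ≤ 1 / t * (2 * L) := by gcongr
  have h3 : -2 * (L / t) = -(1 / t * (2 * L)) := by ring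
  linarith

/-- `4/t` is a supersolution of the recursion forced by `L/t²`. The contraction `exp (-2L/t)` must
beat the growth `t/(t - 1)`, which needs `2L > 1`; `L ≥ log 2 > 0.69` leaves room for the forcing.
-/
lemma harmonic_supersolution {L t : ℝ} (hL : 0.69 ≤ L) (ht : 40 * L ^ 2 + 1 ≤ t) :
    Real.exp (-2 * (L / t)) * (4 / (t - 1)) + L / t ^ 2 ≤ 4 / t := by
  have hL0 : 0 < L := by linarith
  have ht1 : 0 < t - 1 := by nlinarith
  have ht0 : 0 < t := by linarith
  have hexp : Real.exp (-2 * (L / t)) ≤ t / (t + 2 * L) := by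
    have h := Real.add_one_le_exp (2 * (L / t))
    rw [neg_mul, Real.exp_neg, ← inv_div (t + 2 * L) t]
    refine inv_anti₀ (by positivity) ?_
    refine le_trans (le_of_eq ?_) h
    field_simp
    ring
  have hLt : 20 * L * (2 * L) ≤ t := by nlinarith
  -- 27.6 = 40 · 0.69; then `2/27.6 < 0.0725` makes the terms linear in `t` negligible.
  have h27 : 27.6 * L ≤ t := by nlinarith
  calc _ ≤ t / (t + 2 * L) * (4 / (t - 1)) + L / t ^ 2 := by gcongr
    _ ≤ 4 / t := by
      rw [div_mul_div_comm, div_add_div _ _ (by positivity) (by positivity),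
        div_le_div_iff₀ (by positivity) ht0]
      have key : L * (t ^ 2 + (2 * L - 1) * t - 2 * L) ≤ 4 * ((2 * L - 1) * t ^ 2 - 2 * L * t) := by
        have a1 : 2 * L * t ≤ 0.0725 * t ^ 2 := by nlinarith
        have a2 : (2 * L - 1) * t ≤ 0.0725 * t ^ 2 := by nlinarith
        have a3 : L * (t ^ 2 + (2 * L - 1) * t - 2 * L) ≤ L * (1.0725 * t ^ 2) := by
          gcongr; linarith
        have a4 : 0 ≤ ((8 - 1.0725) * L - 4.29) * t ^ 2 := by
          apply mul_nonneg _ (sq_nonneg _); linarith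
        nlinarith
      have := mul_le_mul_of_nonneg_left key ht0.le
      nlinarith

/-- The initial factor `d = exp L` is absorbed by the 2 in `2β`, as `e (β + 1)² ≤ 4 β²` for `β ≥
19`. -/
lemma exp_mul_rpow_le {L β n : ℝ} (hL : 0 ≤ L) (hβ : 19 ≤ β) (hn : 0 < n) :
    Real.exp L * ((β + 1) / (β + n + 1)) ^ (2 * L) ≤ (2 * β / n) ^ (2 * L) := by
  have hexp : Real.exp L = Real.exp 1 ^ L := by rw [← Real.exp_mul, one_mul]
  rw [hexp, Real.rpow_mul (by positivity), Real.rpow_mul (by positivity),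
    ← Real.mul_rpow (by positivity) (by positivity)]
  refine Real.rpow_le_rpow (by positivity) ?_ hL
  rw [Real.rpow_two, Real.rpow_two, div_pow, div_pow]
  have he := Real.exp_one_lt_d9
  calc _ ≤ 2.72 * ((β + 1) ^ 2 / n ^ 2) := by
        gcongr
        · linarith
        · linarith
    _ ≤ _ := by
      rw [← mul_div_assoc]
      gcongr
      nlinarith

/-- The prefactor `meanGrowth² · exp (2 · varianceSum)` serves as an integrating factor. What
remains splits into a homogeneous part, bounded by `exp_neg_mul_rpow_le`, and a noise part, bounded
by `harmonic_supersolution`. -/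
lemma residualBound_le {d : ℕ} {L β l₁ l₂ V : ℝ} (hL : 0.69 ≤ L) (hd : (d : ℝ) = Real.exp L)
    (hl₂ : 0 ≤ l₂) (hl : l₂ < l₁) (hV : 0 ≤ V) (hβ : 40 * L ^ 2 ≤ β) (n : ℕ) :
    residualBound (harmonicStep L (l₁ - l₂) β) d l₁ l₂ V n ≤
      meanGrowth (harmonicStep L (l₁ - l₂) β) l₁ n ^ 2 *
        Real.exp (2 * varianceSum (harmonicStep L (l₁ - l₂) β) (V + l₁ ^ 2) n) *
        (Real.exp L * ((β + 1) / (β + n + 1)) ^ (2 * L) +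
          V * L / (l₁ - l₂) ^ 2 * (4 / (β + n))) := by
  have hg : 0 < l₁ - l₂ := by linarith
  set g := l₁ - l₂ with hgdef
  have hL0 : 0 < L := by linarith
  have hβ0 : 0 < β := by nlinarith
  set η := harmonicStep L g β with hηdef
  have hη : ∀ i, 0 ≤ η i := fun i => by rw [hηdef, harmonicStep]; positivity
  have hl₁ : 0 ≤ l₁ := by linarith
  have hW : 0 ≤ V + l₁ ^ 2 := by positivity
  induction n with
  | zero =>
    have : (β + 1) / (β + 1) = 1 := div_self (by positivity)
    simp only [residualBound, meanGrowth, varianceSum, Finset.range_zero, Finset.prod_empty,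
      Finset.sum_empty, Nat.cast_zero, add_zero, this, Real.one_rpow, hd]
    have : 0 ≤ V * L / g ^ 2 * (4 / β) := by positivity
    simp
    linarith
  | succ n ih =>
    set t : ℝ := β + (n + 1 : ℕ) with ht
    have htn : β + n = t - 1 := by rw [ht]; push_cast; ring
    have htn1 : β + n + 1 = t := by rw [ht]; push_cast; ring
    have ht1 : 40 * L ^ 2 + 1 ≤ t := by
      rw [ht]; push_cast; have : (0 : ℝ) ≤ n := by positivity
      linarith
    have ht0 : 0 < t := by nlinarith
    have htm : 0 < t - 1 := by nlinarith
    have hηn : η (n + 1) = L / (g * t) := rfl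
    have hηg : η (n + 1) * g = L / t := by rw [hηn]; field_simp
    rw [htn1, htn] at ih
    have hfac := residual_factor_le (hη (n + 1)) hl₂ hl.le hV
    rw [← hgdef, hηg] at hfac
    have hmom := momentGrowth_le hη hl₁ hV (show V ≤ V + l₁ ^ 2 by nlinarith) n
    have hvs := varianceSum_nonneg η hW n
    have hτ := residualBound_nonneg η d l₁ l₂ hV n
    set P := meanGrowth η l₁ n with hP
    have hPpos : 0 < P := meanGrowth_pos hη hl₁ n
    set s := varianceSum η (V + l₁ ^ 2) n with hs
    set e := Real.exp (-2 * (L / t)) with he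
    set q := η (n + 1) ^ 2 * (V + l₁ ^ 2) with hq
    have hq0 : 0 ≤ q := by positivity
    have h0 := mul_nonneg (hη (n + 1)) hl₁
    set D := (1 + η (n + 1) * l₁) ^ 2 with hD
    have hD1 : 1 ≤ D := one_le_pow₀ (by linarith)
    have hsecond : momentGrowth η l₁ V n ≤ P ^ 2 * D * Real.exp (2 * (s + q)) := by
      refine hmom.trans ?_
      have : Real.exp s ≤ Real.exp (2 * (s + q)) := Real.exp_le_exp.2 (by linarith)
      calc P ^ 2 * Real.exp s ≤ P ^ 2 * D * Real.exp s := by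
            gcongr; exact le_mul_of_one_le_right (by positivity) hD1
        _ ≤ _ := by gcongr
    have hpow := exp_neg_mul_rpow_le hL0.le ht0 (show 0 < β + 1 by positivity)
    have hsup := harmonic_supersolution hL ht1
    rw [← he] at hpow hsup
    have hηV : η (n + 1) ^ 2 * V = V * L / g ^ 2 * (L / t ^ 2) := by
      rw [hηn]; field_simp
    rw [residualBound, meanGrowth_succ, varianceSum_succ, ← hP, ← hs, ← hq, mul_pow, ← hD]
    calc _ ≤ (D * (Real.exp (2 * q) * e)) * (P ^ 2 * Real.exp (2 * s) *
          (Real.exp L * ((β + 1) / t) ^ (2 * L) + V * L / g ^ 2 * (4 / (t - 1)))) +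
          η (n + 1) ^ 2 * V * (P ^ 2 * D * Real.exp (2 * (s + q))) := by
          gcongr
      _ = P ^ 2 * D * Real.exp (2 * (s + q)) * (Real.exp L * (e * ((β + 1) / t) ^ (2 * L)) +
          V * L / g ^ 2 * (e * (4 / (t - 1)) + L / t ^ 2)) := by
          rw [hηV, mul_add 2 s q, Real.exp_add]
          ring
      _ ≤ _ := by gcongr

lemma residualBound_le_rate {d n : ℕ} {L β l₁ l₂ V : ℝ} (hL : 0.69 ≤ L)
    (hd : (d : ℝ) = Real.exp L) (hl₂ : 0 ≤ l₂) (hl : l₂ < l₁) (hV : 0 ≤ V)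
    (hβ : 40 * ((V + l₁ ^ 2) * L ^ 2 / (l₁ - l₂) ^ 2) ≤ β) (hn : 1 ≤ n) :
    residualBound (harmonicStep L (l₁ - l₂) β) d l₁ l₂ V n ≤
      8 * meanGrowth (harmonicStep L (l₁ - l₂) β) l₁ n ^ 2 *
        (V * L / (l₁ - l₂) ^ 2 * (1 / n) + (2 * β / n) ^ (2 * L)) := by
  have hg : 0 < l₁ - l₂ := by linarith
  have hL0 : 0 < L := by linarith
  have hn0 : (0 : ℝ) < n := by exact_mod_cast hn
  -- Since `0 ≤ l₂`, the gap is at most `l₁`, so `(V + l₁²) / (l₁ - l₂)² ≥ 1`.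
  have hβL : 40 * L ^ 2 ≤ β := by
    refine le_trans ?_ hβ
    gcongr
    rw [le_div_iff₀ (by positivity), mul_comm]
    gcongr
    nlinarith
  have hβ19 : 19 ≤ β := by nlinarith
  have hvs := varianceSum_harmonicStep_le hg (by linarith) (by positivity) hβ n
  have hexp : Real.exp (2 * varianceSum (harmonicStep L (l₁ - l₂) β) (V + l₁ ^ 2) n) ≤ 2 := by
    calc _ ≤ Real.exp (1 / 20) := Real.exp_le_exp.2 (by linarith)
      _ ≤ 2 := by
        have h := Real.exp_bound' (x := 1 / 20) (by norm_num) (by norm_num) (n := 2) (by norm_num)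
        norm_num [Finset.sum_range_succ] at h
        norm_num
        linarith
  refine (residualBound_le hL hd hl₂ hl hV hβL n).trans ?_
  have h1 := exp_mul_rpow_le hL0.le hβ19 hn0
  have h2 : V * L / (l₁ - l₂) ^ 2 * (4 / (β + n)) ≤ V * L / (l₁ - l₂) ^ 2 * (4 / n) := by
    gcongr; linarith
  have h3 : 0 ≤ (2 * β / n) ^ (2 * L) := by positivity
  calc _ ≤ meanGrowth (harmonicStep L (l₁ - l₂) β) l₁ n ^ 2 * 2 *
        (4 * (2 * β / n) ^ (2 * L) + V * L / (l₁ - l₂) ^ 2 * (4 / n)) := by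
        refine mul_le_mul (by gcongr) (by linarith) (by positivity) (by positivity)
    _ = _ := by ring

end Scalar

/-! ### Probabilities of the three bad events. -/

section BadEvents

variable {d n : ℕ} {S : Mat d} {M V : ℝ} {lam : Fin d → ℝ}
  {v : OrthonormalBasis (Fin d) ℝ (Vec d)} {η : ℕ → ℝ}
  {μ : Fin n → Measure (Mat d)} [∀ i, IsProbabilityMeasure (μ i)]

lemma measurable_of_continuous_prod {f : Vec d → (Fin n → Mat d) → ℝ}
    (hf : Continuous fun p : Vec d × (Fin n → Mat d) => f p.1 p.2) :
    Measurable fun p : Metric.sphere (0 : Vec d) 1 × (Fin n → Mat d) => f (p.1 : Vec d) p.2 :=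
  hf.measurable.comp ((measurable_subtype_coe.comp measurable_fst).prodMk measurable_snd)

lemma measure_inner_ojaMat_lt_le (hE : IsOrderedEigenbasis S lam v) (hS : S.PosSemidef)
    (hV : 0 ≤ V) (hμ : ∀ i, IsCentredNoise (μ i) (fun A => A - S) M V) (k : Fin d)
    (hl : ∀ i, lam i ≤ lam k) (hη : ∀ i, 0 ≤ η i) :
    Measure.pi μ {A | inner ℝ (v k) (matVec (ojaMat η n A) (v k)) < meanGrowth η (lam k) n / 2} ≤
      ENNReal.ofReal (4 * ∑ i ∈ Finset.range n, η (i + 1) ^ 2 * V *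
        (momentGrowth η (lam k) V i / meanGrowth η (lam k) (i + 1) ^ 2)) := by
  have hP := meanGrowth_pos hη (hE.nonneg hS k) n
  have h := lintegral_inner_ojaMat_sub_sq_le (n := n) hE hS hV hμ k hl hη
  have hm : Measurable fun A : Fin n → Mat d => ENNReal.ofReal ((inner ℝ (v k)
      (matVec (ojaMat η n A) (v k)) / meanGrowth η (lam k) n - 1) ^ 2) :=
    measurable_ofReal_of_continuous (by
      have := hP.ne'
      fun_prop (disch := exact this))
  -- Chebyshev at relative deviation 1/2, hence the threshold 1/4.
  have hmarkov := meas_ge_le_lintegral_div (μ := Measure.pi μ) hm.aemeasurable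
    (ε := ENNReal.ofReal (1 / 4)) (by simp) (by simp)
  refine (measure_mono ?_).trans (hmarkov.trans ?_)
  · intro A hA
    refine ENNReal.ofReal_le_ofReal ?_
    have h1 : inner ℝ (v k) (matVec (ojaMat η n A) (v k)) / meanGrowth η (lam k) n ≤ 1 / 2 := by
      rw [div_le_iff₀ hP]
      linarith [show inner ℝ (v k) (matVec (ojaMat η n A) (v k)) < meanGrowth η (lam k) n / 2 from hA]
    nlinarith
  · refine (ENNReal.div_le_div_right h _).trans (le_of_eq ?_)
    rw [← ENNReal.ofReal_div_of_pos (by norm_num)]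
    congr 1
    ring

/-- For fixed matrices this is anti-concentration of `w₀` against the vector `Bᵀ u`; independence
allows integrating over `w₀` first. -/
lemma measure_abs_inner_ojaMat_lt_le (hd : 2 ≤ d) (u : Vec d) {c : ℝ} (hc : 0 < c) :
    (uniformSphere d).prod (Measure.pi μ) {p | |inner ℝ u (matVec (ojaMat η n p.2) p.1)| <
      c * ‖matVec (ojaMat η n p.2)ᵀ u‖ / √d} ≤ ENNReal.ofReal (2 * c) := by
  have : NeZero d := ⟨by omega⟩
  have hm : MeasurableSet {p : Metric.sphere (0 : Vec d) 1 × (Fin n → Mat d) |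
      |inner ℝ u (matVec (ojaMat η n p.2) p.1)| < c * ‖matVec (ojaMat η n p.2)ᵀ u‖ / √d} :=
    measurableSet_lt
      (measurable_of_continuous_prod (f := fun w A => |inner ℝ u (matVec (ojaMat η n A) w)|)
        (by fun_prop))
      (measurable_of_continuous_prod (f := fun _ A => c * ‖matVec (ojaMat η n A)ᵀ u‖ / √d)
        (by fun_prop))
  rw [Measure.prod_apply_symm hm]
  calc _ ≤ ∫⁻ _, ENNReal.ofReal (2 * c) ∂Measure.pi μ := by
        refine lintegral_mono fun A => ?_
        refine le_trans (le_of_eq ?_) (uniformSphere_abs_inner_lt_le hd (matVec (ojaMat η n A)ᵀ u) hc)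
        simp only [inner_matVec_transpose]
        rfl
    _ = _ := by simp

lemma sum_norm_sq_comm (v : OrthonormalBasis (Fin d) ℝ (Vec d)) (T : Vec d →L[ℝ] Vec d) :
    ∑ j, ‖ContinuousLinearMap.adjoint T (v j)‖ ^ 2 = ∑ j, ‖T (v j)‖ ^ 2 := by
  calc _ = ∑ j, ∑ i, inner ℝ (v i) (ContinuousLinearMap.adjoint T (v j)) ^ 2 := by
        simp_rw [v.sum_sq_inner_right]
    _ = ∑ i, ∑ j, inner ℝ (T (v i)) (v j) ^ 2 := by
        rw [Finset.sum_comm]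
        simp_rw [ContinuousLinearMap.adjoint_inner_right]
    _ = _ := by simp_rw [v.sum_sq_inner_left]

/-- A uniform vector has covariance `1/d` times the identity, so the average is the squared
Frobenius norm over `d`. -/
lemma lintegral_norm_sq_uniformSphere [NeZero d] (v : OrthonormalBasis (Fin d) ℝ (Vec d))
    (T : Vec d →L[ℝ] Vec d) :
    ∫⁻ w : Metric.sphere (0 : Vec d) 1, ENNReal.ofReal (‖T w‖ ^ 2) ∂uniformSphere d =
      ENNReal.ofReal ((∑ j, ‖T (v j)‖ ^ 2) / d) := by
  have h : ∀ w : Metric.sphere (0 : Vec d) 1, ENNReal.ofReal (‖T w‖ ^ 2) =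
      ∑ j, ENNReal.ofReal (inner ℝ (ContinuousLinearMap.adjoint T (v j)) (w : Vec d) ^ 2) := by
    intro w
    rw [← ENNReal.ofReal_sum_of_nonneg fun j _ => sq_nonneg _]
    simp_rw [ContinuousLinearMap.adjoint_inner_left, v.sum_sq_inner_right]
  rw [lintegral_congr h, lintegral_finsetSum _ fun j _ => by fun_prop]
  simp_rw [lintegral_inner_sq_uniformSphere]
  rw [← ENNReal.ofReal_sum_of_nonneg fun j _ => by positivity, ← Finset.sum_div,
    sum_norm_sq_comm]

lemma measure_norm_perp_ojaMat_ge_le (hd : 2 ≤ d) (hE : IsOrderedEigenbasis S lam v)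
    (hS : S.PosSemidef) (hV : 0 ≤ V) (hμ : ∀ i, IsCentredNoise (μ i) (fun A => A - S) M V)
    (hμ' : ∀ i, IsCentredNoise (μ i) (fun A => (A - S)ᵀ) M V) (k : Fin d) {l₁ l₂ K : ℝ}
    (hl₁ : ∀ i, lam i ≤ l₁) (hl₂ : ∀ i, i ≠ k → lam i ≤ l₂) (hη : ∀ i, 0 ≤ η i) (hK : 0 < K)
    (hpos : 0 < residualBound η d l₁ l₂ V n) :
    (uniformSphere d).prod (Measure.pi μ) {p | K * residualBound η d l₁ l₂ V n / d ≤
      ‖perp (v k) (matVec (ojaMat η n p.2) p.1)‖ ^ 2} ≤ ENNReal.ofReal (1 / K) := by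
  have : NeZero d := ⟨by omega⟩
  have hd0 : (0 : ℝ) < d := by exact_mod_cast (by omega : 0 < d)
  set τ := residualBound η d l₁ l₂ V n with hτ
  have hm : Measurable fun p : Metric.sphere (0 : Vec d) 1 × (Fin n → Mat d) =>
      ENNReal.ofReal (‖perp (v k) (matVec (ojaMat η n p.2) p.1)‖ ^ 2) :=
    (measurable_of_continuous_prod
      (f := fun w A => ‖perp (v k) (matVec (ojaMat η n A) w)‖ ^ 2) (by fun_prop)).ennreal_ofReal
  have hint : ∫⁻ p, ENNReal.ofReal (‖perp (v k) (matVec (ojaMat η n p.2) p.1)‖ ^ 2)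
      ∂(uniformSphere d).prod (Measure.pi μ) ≤ ENNReal.ofReal (τ / d) := by
    rw [lintegral_prod_symm _ hm.aemeasurable]
    calc _ = ∫⁻ A, ENNReal.ofReal (1 / d) * ENNReal.ofReal
          (∑ j, ‖perp (v k) (matVec (ojaMat η n A) (v j))‖ ^ 2) ∂Measure.pi μ := by
          refine lintegral_congr fun A => ?_
          rw [← ENNReal.ofReal_mul (by positivity), one_div_mul_eq_div]
          exact lintegral_norm_sq_uniformSphere v
            ((perp (v k)).comp (Matrix.toEuclideanCLM (𝕜 := ℝ) (ojaMat η n A)))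
      _ ≤ ENNReal.ofReal (1 / d) * ENNReal.ofReal τ := by
          rw [lintegral_const_mul _ (measurable_ofReal_of_continuous (by fun_prop))]
          gcongr
          exact lintegral_perp_ojaMat_le hE hS hV hμ hμ' k hl₁ hl₂ hη
      _ = _ := by
          rw [← ENNReal.ofReal_mul (by positivity), one_div_mul_eq_div]
  have hmarkov := meas_ge_le_lintegral_div (μ := (uniformSphere d).prod (Measure.pi μ))
    hm.aemeasurable (ε := ENNReal.ofReal (K * τ / d))
    (by simpa using by positivity) (by simp)
  refine (measure_mono ?_).trans (hmarkov.trans ?_)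
  · intro p hp
    exact ENNReal.ofReal_le_ofReal hp
  · refine (ENNReal.div_le_div_right hint _).trans (le_of_eq ?_)
    rw [← ENNReal.ofReal_div_of_pos (by positivity)]
    congr 1
    field_simp

lemma residualBound_pos (hη : ∀ i, 0 ≤ η i) (hd : 0 < d) {l₁ l₂ : ℝ} (hl₂ : 0 ≤ l₂)
    (hV : 0 ≤ V) (n : ℕ) : 0 < residualBound η d l₁ l₂ V n := by
  induction n with
  | zero => simpa [residualBound] using hd
  | succ n ih =>
    have h0 := mul_nonneg (hη (n + 1)) hl₂
    have h1 := momentGrowth_nonneg η l₁ hV n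
    rw [residualBound]
    positivity

end BadEvents

/-! ### From the good events to the angle. -/

section Angle

variable {d : ℕ}

lemma sinSq_smul_le {u y : Vec d} (hu : ‖u‖ = 1) (hy : inner ℝ u y ≠ 0) :
    sinSq (‖y‖⁻¹ • y) u ≤ ‖perp u y‖ ^ 2 / inner ℝ u y ^ 2 := by
  have hy0 : y ≠ 0 := by rintro rfl; simp at hy
  have hpos : 0 < ‖y‖ := norm_pos_iff.2 hy0
  have hi : 0 < inner ℝ u y ^ 2 := by positivity
  have hle : inner ℝ u y ^ 2 ≤ ‖y‖ ^ 2 := by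
    have := norm_perp_sq hu y
    nlinarith [sq_nonneg ‖perp u y‖]
  rw [sinSq, real_inner_smul_left, real_inner_comm, mul_pow, norm_perp_sq hu, inv_pow]
  calc _ = (‖y‖ ^ 2 - inner ℝ u y ^ 2) / ‖y‖ ^ 2 := by field_simp
    _ ≤ _ := by gcongr

/-- The lower bounds combine to `⟨u, B w⟩² ≥ P² / (6400 d)`, with 6400 = (2 · 40)². Dividing `20 τ /
d` by this cancels `d` and gives 128000 = 20 · 6400. -/
lemma ojaOutput_spec {n : ℕ} {η : ℕ → ℝ} {A : Fin n → Mat d} {w u : Vec d} {τ P : ℝ}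
    (hd : 2 ≤ d) (hw : ‖w‖ = 1) (hu : ‖u‖ = 1) (hP : 0 < P)
    (h₁ : P / 2 ≤ inner ℝ u (matVec (ojaMat η n A) u))
    (h₂ : 1 / 40 * ‖matVec (ojaMat η n A)ᵀ u‖ / √d ≤ |inner ℝ u (matVec (ojaMat η n A) w)|)
    (h₃ : ‖perp u (matVec (ojaMat η n A) w)‖ ^ 2 ≤ 20 * τ / d) :
    ‖ojaOutput η n A w‖ = 1 ∧ sinSq (ojaOutput η n A w) u ≤ 128000 * (τ / P ^ 2) := by
  have hd0 : (0 : ℝ) < d := by exact_mod_cast (by omega : 0 < d)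
  set y := matVec (ojaMat η n A) w with hy
  have hBt : P / 2 ≤ ‖matVec (ojaMat η n A)ᵀ u‖ := by
    calc _ ≤ _ := h₁
      _ = inner ℝ (matVec (ojaMat η n A)ᵀ u) u := (inner_matVec_transpose _ _ _).symm
      _ ≤ ‖matVec (ojaMat η n A)ᵀ u‖ * ‖u‖ := real_inner_le_norm _ _
      _ = _ := by rw [hu, mul_one]
  have hlow : P / (80 * √d) ≤ |inner ℝ u y| := by
    refine le_trans ?_ h₂
    calc _ = 1 / 40 * (P / 2) / √d := by field_simp; norm_num
      _ ≤ _ := by gcongr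
  have hlow' : P ^ 2 / (6400 * d) ≤ inner ℝ u y ^ 2 := by
    rw [← sq_abs (inner ℝ u y)]
    calc _ = (P / (80 * √d)) ^ 2 := by
          rw [div_pow, mul_pow, Real.sq_sqrt hd0.le]; norm_num
      _ ≤ _ := by gcongr
  have hpos : 0 < P ^ 2 / (6400 * d) := by positivity
  have hne : inner ℝ u y ≠ 0 := by
    intro h0
    rw [h0] at hlow'
    norm_num at hlow'
    linarith
  have hy0 : y ≠ 0 := by rintro h0; simp [h0] at hne
  rw [ojaOutput_eq η n A hw hy0, ← hy]
  refine ⟨?_, (sinSq_smul_le hu hne).trans ?_⟩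
  · rw [norm_smul, norm_inv, norm_norm, inv_mul_cancel₀ (norm_ne_zero_iff.2 hy0)]
  · have hτ : 0 ≤ 20 * τ / d := (sq_nonneg _).trans h₃
    calc _ ≤ (20 * τ / d) / (P ^ 2 / (6400 * d)) := by gcongr
      _ = _ := by field_simp; ring

end Angle

/-! ### Passing from the probability space to product laws. -/

section Model

variable {Ω : Type*} [MeasurableSpace Ω] {P : Measure Ω} {d n : ℕ}
  {A : Fin n → Ω → Mat d} {S : Mat d} {M V : ℝ}

lemma measurable_entry (i j : Fin d) : Measurable fun B : Mat d => B i j :=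
  (measurable_pi_apply j).comp (measurable_pi_apply i)

lemma expMat_map {X : Ω → Mat d} (hX : Measurable X) {f : Mat d → Mat d} (hf : Continuous f) :
    expMat (P.map X) f = expMat P fun ω => f (X ω) := by
  ext i j
  exact integral_map hX.aemeasurable
    ((measurable_entry i j).comp hf.measurable).aestronglyMeasurable

lemma expMat_sub_const [IsProbabilityMeasure P] {X : Ω → Mat d}
    (hX : ∀ i j, Integrable (fun ω => X ω i j) P) :
    expMat P (fun ω => X ω - S) = expMat P X - S := by
  ext i j
  simp only [expMat, Matrix.of_apply, Matrix.sub_apply]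
  rw [integral_sub (hX i j) (integrable_const _)]
  simp

lemma continuous_specNorm : Continuous (specNorm : Mat d → ℝ) :=
  continuous_norm.comp (LinearMap.continuous_of_finiteDimensional
    { toFun := Matrix.toEuclideanCLM (n := Fin d) (𝕜 := ℝ)
      map_add' := map_add _
      map_smul' := map_smul _ })

lemma StreamingPCA.integrable [IsProbabilityMeasure P] (h : StreamingPCA P A S M V)
    (i : Fin n) (j k : Fin d) :
    Integrable (fun ω => A i ω j k) P := by
  refine Integrable.of_bound (C := M + |S j k|)
    ((measurable_entry j k).comp (h.measurable i)).aestronglyMeasurable ?_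
  filter_upwards [h.bound i] with ω hω
  have h1 := (abs_entry_le_specNorm (A i ω - S) j k).trans hω
  rw [Matrix.sub_apply] at h1
  rw [Real.norm_eq_abs]
  linarith [abs_sub_abs_le_abs_sub (A i ω j k) (S j k)]

lemma StreamingPCA.isCentredNoise [IsProbabilityMeasure P] (h : StreamingPCA P A S M V)
    (i : Fin n) :
    IsCentredNoise (P.map (A i)) (fun B => B - S) M V where
  measurable := Continuous.measurable (by fun_prop)
  bound := by
    have hc : Continuous fun B : Mat d => specNorm (B - S) :=
      continuous_specNorm.comp (continuous_id.sub continuous_const)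
    rw [ae_map_iff (h.measurable i).aemeasurable (measurableSet_le hc.measurable measurable_const)]
    exact h.bound i
  mean := by
    rw [expMat_map (h.measurable i) (by fun_prop), expMat_sub_const (h.integrable i), h.mean,
      sub_self]
  variance := by
    rw [expMat_map (h.measurable i) (by fun_prop)]
    exact (le_max_right _ _).trans (h.variance i)

lemma StreamingPCA.isCentredNoise_transpose [IsProbabilityMeasure P]
    (h : StreamingPCA P A S M V) (i : Fin n) :
    IsCentredNoise (P.map (A i)) (fun B => (B - S)ᵀ) M V where
  measurable := Continuous.measurable (by fun_prop)
  bound := by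
    simp only [specNorm_transpose]
    exact (h.isCentredNoise i).bound
  mean := by
    have h0 := (h.isCentredNoise i).mean
    ext j k
    exact congrFun (congrFun h0 k) j
  variance := by
    simp only [Matrix.transpose_transpose]
    rw [expMat_map (h.measurable i) (by fun_prop)]
    exact (le_max_left _ _).trans (h.variance i)

lemma StreamingPCA.variance_nonneg (h : StreamingPCA P A S M V) (hn : 1 ≤ n) : 0 ≤ V :=
  (specNorm_nonneg _).trans ((le_max_left _ _).trans (h.variance ⟨0, hn⟩))

lemma StreamingPCA.map_prod [IsProbabilityMeasure P] (h : StreamingPCA P A S M V)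
    {w₀ : Ω → Metric.sphere (0 : Vec d) 1} (hw : Measurable w₀)
    (hw₀ : P.map w₀ = uniformSphere d) (hind : IndepFun w₀ (fun ω i => A i ω) P) :
    P.map (fun ω => (w₀ ω, fun i => A i ω)) =
      (uniformSphere d).prod (Measure.pi fun i => P.map (A i)) := by
  have hA : Measurable fun ω i => A i ω := measurable_pi_lambda _ h.measurable
  rw [(indepFun_iff_map_prod_eq_prod_map_map hw.aemeasurable hA.aemeasurable).1 hind, hw₀,
    (iIndepFun_iff_map_fun_eq_pi_map fun i => (h.measurable i).aemeasurable).1 h.indep]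

end Model

end

theorem theorem1p3 :
    ∃ C : ℝ, 0 < C ∧
      ∀ (d n : ℕ) (hd : 2 ≤ d) (_hn : 1 ≤ n)
        (Ω : Type*) [MeasurableSpace Ω] (P : Measure Ω) [IsProbabilityMeasure P]
        (A : Fin n → Ω → Mat d) (S : Mat d) (M V : ℝ)
        (lam : Fin d → ℝ) (v : OrthonormalBasis (Fin d) ℝ (Vec d))
        (w₀ : Ω → Metric.sphere (0 : Vec d) 1) (l₁ l₂ : ℝ),
        StreamingPCA P A S M V →
        IsOrderedEigenbasis S lam v →
        l₁ = lam ⟨0, by omega⟩ → l₂ = lam ⟨1, by omega⟩ → l₂ < l₁ →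
        Measurable w₀ → P.map w₀ = uniformSphere d →
        IndepFun w₀ (fun ω i => A i ω) P →
        3 / 4 < P.real {ω |
          ‖ojaOutput (ojaStepSize d l₁ l₂ M V) n (fun i => A i ω) (w₀ ω : Vec d)‖ = 1 ∧
          sinSq (ojaOutput (ojaStepSize d l₁ l₂ M V) n (fun i => A i ω) (w₀ ω : Vec d))
              (v ⟨0, by omega⟩) ≤
            C * (V * Real.log d / (l₁ - l₂) ^ 2 * (1 / n) +
              (2 * ojaBeta d l₁ l₂ M V / n) ^ (2 * Real.log d))} := by
  -- 1024000 = 128000 · 8, the constants of `ojaOutput_spec` and `residualBound_le_rate`.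
  refine ⟨1024000, by norm_num, ?_⟩
  intro d n hd hn Ω _ P _ A S M V lam v w₀ l₁ l₂ hA hE hl₁ hl₂ hlt hw hw₀ hind
  have : NeZero d := ⟨by omega⟩
  have hS := hA.posSemidef
  have hV := hA.variance_nonneg hn
  set k : Fin d := ⟨0, by omega⟩ with hk
  set L := Real.log d with hL
  set β := ojaBeta d l₁ l₂ M V with hβ
  have hd0 : (0 : ℝ) < d := by exact_mod_cast (by omega : 0 < d)
  have hdL : (d : ℝ) = Real.exp L := (Real.exp_log hd0).symm
  have hL69 : 0.69 ≤ L := by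
    have h1 : Real.log 2 ≤ L := Real.log_le_log (by norm_num) (by exact_mod_cast hd)
    linarith [Real.log_two_gt_d9]
  have hL0 : 0 < L := by linarith
  have hl₂0 : 0 ≤ l₂ := by rw [hl₂]; exact hE.nonneg hS _
  have hl₁0 : 0 ≤ l₁ := hl₂0.trans hlt.le
  have hg : 0 < l₁ - l₂ := by linarith
  have hl₁pos : 0 < l₁ := by linarith
  have hβge : 40 * ((V + l₁ ^ 2) * L ^ 2 / (l₁ - l₂) ^ 2) ≤ β := by
    rw [hβ, ojaBeta]
    gcongr
    exact le_max_right _ _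
  have hβ0 : 0 < β := lt_of_lt_of_le (by positivity) hβge
  have hηeq : ojaStepSize d l₁ l₂ M V = harmonicStep L (l₁ - l₂) β := rfl
  set η := harmonicStep L (l₁ - l₂) β with hη
  have hη0 : ∀ i, 0 ≤ η i := fun i => by rw [hη, harmonicStep]; positivity
  have hlam₁ : ∀ i, lam i ≤ l₁ := fun i => by
    rw [hl₁]; exact hE.antitone (Fin.mk_le_of_le_val (Nat.zero_le _))
  have hlam₂ : ∀ i, i ≠ k → lam i ≤ l₂ := fun i hi => by
    rw [hl₂]
    refine hE.antitone (Fin.mk_le_of_le_val ?_)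
    have : i.val ≠ 0 := fun h => hi (Fin.ext h)
    omega
  have hl₁k : lam k = l₁ := hl₁.symm
  have hprob : ∀ i, IsProbabilityMeasure (P.map (A i)) := fun i =>
    Measure.isProbabilityMeasure_map (hA.measurable i).aemeasurable
  have hτpos := residualBound_pos (n := n) (l₁ := l₁) (V := V) hη0 (show 0 < d by omega) hl₂0 hV
  have hτ := residualBound_le_rate hL69 hdL hl₂0 hlt hV hβge hn
  have hG := meanGrowth_pos hη0 hl₁0 n
  rw [← hη] at hτ
  set τ := residualBound η d l₁ l₂ V n
  set G := meanGrowth η l₁ n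
  set ν := (uniformSphere d).prod (Measure.pi fun i => P.map (A i)) with hν
  set B₁ : Set (Metric.sphere (0 : Vec d) 1 × (Fin n → Mat d)) :=
    {p | inner ℝ (v k) (matVec (ojaMat η n p.2) (v k)) < G / 2}
  set B₂ : Set (Metric.sphere (0 : Vec d) 1 × (Fin n → Mat d)) :=
    {p | |inner ℝ (v k) (matVec (ojaMat η n p.2) p.1)| <
      1 / 40 * ‖matVec (ojaMat η n p.2)ᵀ (v k)‖ / √d}
  set B₃ : Set (Metric.sphere (0 : Vec d) 1 × (Fin n → Mat d)) :=
    {p | 20 * τ / d ≤ ‖perp (v k) (matVec (ojaMat η n p.2) p.1)‖ ^ 2}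
  have h₁ : ν B₁ ≤ ENNReal.ofReal (13 / 125) := by
    have hB : B₁ = Set.univ ×ˢ {C : Fin n → Mat d |
        inner ℝ (v k) (matVec (ojaMat η n C) (v k)) < G / 2} := by
      ext p; simp [B₁]
    rw [hB, hν, Measure.prod_prod, measure_univ, one_mul]
    have h := measure_inner_ojaMat_lt_le hE hS hV hA.isCentredNoise k
      (by rw [hl₁k]; exact hlam₁) hη0
    rw [hl₁k] at h
    refine h.trans (ENNReal.ofReal_le_ofReal ?_)
    have := sum_variance_mul_ratio_le hη0 hl₁0 hV (show V ≤ V + l₁ ^ 2 by nlinarith)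
      (varianceSum_harmonicStep_le hg hβ0 (by positivity) hβge) n
    linarith
  have h₂ : ν B₂ ≤ ENNReal.ofReal (1 / 20) := by
    refine (measure_abs_inner_ojaMat_lt_le hd (v k) (by norm_num)).trans (le_of_eq ?_)
    norm_num
  have h₃ : ν B₃ ≤ ENNReal.ofReal (1 / 20) :=
    measure_norm_perp_ojaMat_ge_le hd hE hS hV hA.isCentredNoise hA.isCentredNoise_transpose k
      hlam₁ hlam₂ hη0 (by norm_num) hτpos
  have hB : ν (B₁ ∪ B₂ ∪ B₃) ≤ ENNReal.ofReal (51 / 250) := by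
    calc _ ≤ ν B₁ + ν B₂ + ν B₃ :=
          (measure_union_le _ _).trans (add_le_add_left (measure_union_le _ _) _)
      _ ≤ ENNReal.ofReal (13 / 125) + ENNReal.ofReal (1 / 20) + ENNReal.ofReal (1 / 20) := by
          gcongr
      _ = _ := by
          rw [← ENNReal.ofReal_add (by norm_num) (by norm_num),
            ← ENNReal.ofReal_add (by norm_num) (by norm_num)]
          norm_num
  have hΦ : Measurable fun ω => (w₀ ω, fun i => A i ω) :=
    hw.prodMk (measurable_pi_lambda _ hA.measurable)
  have hpre : P ((fun ω => (w₀ ω, fun i => A i ω)) ⁻¹' (B₁ ∪ B₂ ∪ B₃)) ≤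
      ENNReal.ofReal (51 / 250) := by
    -- This inequality holds for arbitrary sets, so measurability of the bad events is not needed.
    refine (Measure.le_map_apply hΦ.aemeasurable _).trans ?_
    rwa [hA.map_prod hw hw₀ hind]
  rw [hηeq]
  set E := {ω | ‖ojaOutput η n (fun i => A i ω) (w₀ ω : Vec d)‖ = 1 ∧
    sinSq (ojaOutput η n (fun i => A i ω) (w₀ ω : Vec d)) (v k) ≤
      1024000 * (V * L / (l₁ - l₂) ^ 2 * (1 / n) + (2 * β / n) ^ (2 * L))} with hEdef
  have hsub : Eᶜ ⊆ (fun ω => (w₀ ω, fun i => A i ω)) ⁻¹' (B₁ ∪ B₂ ∪ B₃) := by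
    intro ω hω
    by_contra hcon
    refine hω ?_
    simp only [Set.mem_preimage, Set.mem_union, not_or, B₁, B₂, B₃, Set.mem_ofPred_eq, not_lt,
      not_le] at hcon
    obtain ⟨⟨c₁, c₂⟩, c₃⟩ := hcon
    obtain ⟨g₁, g₂⟩ := ojaOutput_spec hd (by simp) (v.norm_eq_one k) hG c₁ c₂ c₃.le
    refine ⟨g₁, g₂.trans ?_⟩
    have : τ / G ^ 2 ≤ 8 * (V * L / (l₁ - l₂) ^ 2 * (1 / n) + (2 * β / n) ^ (2 * L)) := by
      rw [div_le_iff₀ (by positivity)]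
      linarith
    linarith
  have hcompl : P.real Eᶜ ≤ 51 / 250 := by
    refine ENNReal.toReal_le_of_le_ofReal (by norm_num) ((measure_mono hsub).trans hpre)
  -- Subadditivity avoids proving that `E` is measurable.
  have hone : 1 ≤ P.real E + P.real Eᶜ := by
    rw [← probReal_univ (μ := P), ← Set.union_compl_self E]
    exact measureReal_union_le _ _
  linarith
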